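/- Let $n\in\mathbb N$, let $|\cdot|$ be the Euclidean norm on $\mathbb R^n$, let $\mathbb B$ be the closed unit ball, and for $x\in\mathbb R^n$, $A\subseteq\mathbb R^n$ put $|x|_A=\inf_{y\in A}|x-y|$ (with $\inf\emptyset=\infty$). Sums of sets are Minkowski sums. A hybrid system $\mathcal H=(C,F,D,G)$ consists of sets $C,D\subseteq\mathbb R^n$ and set-valued maps $F,G:\mathbb R^n\rightrightarrows\mathbb R^n$. It satisfies the *hybrid basic conditions* if $C,D$ are closed, $F$ is outer semicontinuous and locally bounded relative to $C$ with $F(x)$ convex for all $x\in C$, and $G$ is outer semicontinuous and locally bounded relative to $D$. For $\delta\ge 0$ its perturbation is $\mathcal H_\delta=(C+\delta\mathbb B,\;F+\delta\mathbb B,\;D+\delta\mathbb B,\;G+\delta\mathbb B)$. A *hybrid time domain* is a union of intervals $[t_j,t_{j+1}]\times\{j\}$ with $0=t_0\le t_1\le\cdots$, taken over all $j\in\mathbb N$ or over $0\le j\le J$ for some $J\in\mathbb N$; in the latter case the last interval may also be of the form $[t_J,T)$ with $t_J<T\le\infty$. A *hybrid arc* is a function $\phi:\operatorname{dom}\phi\to\mathbb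 R^n$ on a hybrid time domain such that, for each $j$, $t\mapsto\phi(t,j)$ is locally absolutely continuous on $I^j=\{t:(t,j)\in\operatorname{dom}\phi\}$. It is a *solution* to $(C,F,D,G)$ if $\phi(0,0)\in\overline C\cup D$; if for every $j$ with $\operatorname{int}I^j\ne\emptyset$ one has $\phi(t,j)\in C$ for all $t\in\operatorname{int}I^j$ and $\dot\phi(t,j)\in F(\phi(t,j))$ for almost all $t\in I^j$; and if $\phi(t,j)\in D$, $\phi(t,j+1)\in G(\phi(t,j))$ whenever $(t,j),(t,j+1)\in\operatorname{dom}\phi$. It is *maximal* if no solution extends it to a strictly larger domain, *complete* if $\operatorname{dom}\phi$ is unbounded, and *bounded* if its range $\operatorname{rge}\phi$ is bounded. Solutions to $\mathcal H_\delta$ are those to its four data above. "From $X_0$" means $\phi(0,0)\in X_0$. A closed set $A$ is *uniformly pre-asymptotically stable* (UpAS) for $\mathcal H_\delta$ if (i) for every $\varepsilon>0$ there is $r>0$ such that every solution $\phi$ to $\mathcal H_\delta$ with $|\phi(0,0)|_A<r$ satisfies $|\phi(t,j)|_A<\varepsilon$ on $\operatorname{dom}\phi$; and (ii) there is $\rho>0$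 such that for every $\varepsilon>0$ there is $T>0$ such that every solution $\phi$ to $\mathcal H_\delta$ with $|\phi(0,0)|_A<\rho$ satisfies $|\phi(t,j)|_A<\varepsilon$ for all $(t,j)\in\operatorname{dom}\phi$ with $t+j\ge T$. The *basin of pre-attraction* $\mathfrak B_\delta(A)$ is the set of $x\in\mathbb R^n$ such that every solution $\phi$ to $\mathcal H_\delta$ with $\phi(0,0)=x$ is bounded and, if complete, satisfies $|\phi(t,j)|_A\to0$ as $t+j\to\infty$. $\mathcal H_\delta$ satisfies the *stability with safety guarantee specification* $(X_0,U,A)$ if $A$ is UpAS for $\mathcal H_\delta$, $X_0\subseteq\mathfrak B_\delta(A)$, and $\operatorname{rge}\phi\cap U=\emptyset$ for all maximal solutions $\phi$ to $\mathcal H_\delta$ from $X_0$. It satisfies the *reach-avoid-stay specification* $(X_0,U,\Gamma)$ if there is $T\ge0$ such that $\phi(t,j)\in\Gamma$ for every maximal solution $\phi$ to $\mathcal H_\delta$ from $X_0$ and all $(t,j)\in\operatorname{dom}\phi$ with $t+j\ge T$, and $\operatorname{rge}\phi\cap U=\emptyset$ for all these $\phi$. **Proposition.** Let $\mathcal H$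 be a hybrid system on $\mathbb R^n$ and $\delta\ge0$ such that $\mathcal H_\delta$ satisfies the hybrid basic conditions. Let $A,X_0\subseteq\mathbb R^n$ be compact and $U\subseteq\mathbb R^n$ arbitrary. If $\mathcal H_\delta$ satisfies the stability with safety guarantee specification $(X_0,U,A)$, then for every $\varepsilon>0$ it also satisfies the reach-avoid-stay specification $(X_0,U,A+\varepsilon\mathbb B)$. -/

import Mathlib

open Set Filter Topology MeasureTheory
open scoped Pointwise

/-- A hybrid time domain: a union of intervals `[t_j, t_{j+1}] × {j}` with
`0 = t_0 ≤ t_1 ≤ ⋯`, over all `j`, or over `j ≤ J` where the last interval may also be of the form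
`[t_J, T)` with `t_J < T ≤ ∞`. -/
def IsHybridTimeDomain (E : Set (ℝ × ℕ)) : Prop :=
  ∃ t : ℕ → ℝ, t 0 = 0 ∧ Monotone t ∧
    (E = {p | p.1 ∈ Icc (t p.2) (t (p.2 + 1))} ∨
      ∃ (J : ℕ) (I : Set ℝ),
        (I = Icc (t J) (t (J + 1)) ∨
          (t J < t (J + 1) ∧ I = Ico (t J) (t (J + 1))) ∨
          I = Ici (t J)) ∧
        E = {p | (p.2 < J ∧ p.1 ∈ Icc (t p.2) (t (p.2 + 1))) ∨ (p.2 = J ∧ p.1 ∈ I)})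

/-- A hybrid arc in `ℝⁿ`. Only the values `val t j` with `(t, j) ∈ dom` are meaningful. -/
structure HybridArc (n : ℕ) where
  dom : Set (ℝ × ℕ)
  val : ℝ → ℕ → EuclideanSpace ℝ (Fin n)
  isHybridTimeDomain : IsHybridTimeDomain dom
  locallyAC : ∀ (j : ℕ) (a b : ℝ), (a, j) ∈ dom → (b, j) ∈ dom →
    AbsolutelyContinuousOnInterval (fun t => val t j) a b

namespace HybridArc

variable {n : ℕ}

/-- The interval `I^j = {t | (t, j) ∈ dom φ}`. -/
def flowInterval (φ : HybridArc n) (j : ℕ) : Set ℝ := {t | (t, j) ∈ φ.dom}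

def rge (φ : HybridArc n) : Set (EuclideanSpace ℝ (Fin n)) :=
  {x | ∃ t j, (t, j) ∈ φ.dom ∧ x = φ.val t j}

def IsBounded (φ : HybridArc n) : Prop := Bornology.IsBounded φ.rge

/-- The domain of `φ` is unbounded. -/
def IsComplete (φ : HybridArc n) : Prop :=
  ∀ T : ℝ, ∃ (t : ℝ) (j : ℕ), (t, j) ∈ φ.dom ∧ T ≤ t + j

/-- `|φ(t,j)|_A → 0` as `t + j → ∞` in `dom φ`. The distance to a set is the extended one, so
that the distance to the empty set is `∞`. -/
def ConvergesTo (φ : HybridArc n) (A : Set (EuclideanSpace ℝ (Fin n))) : Prop :=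
  ∀ ε : ℝ, 0 < ε → ∃ T : ℝ, ∀ (t : ℝ) (j : ℕ), (t, j) ∈ φ.dom → T ≤ t + j →
    Metric.infEDist (φ.val t j) A < ENNReal.ofReal ε

end HybridArc

/-- A hybrid system `(C, F, D, G)` on `ℝⁿ`: flow set and map, jump set and map. -/
structure HybridSystem (n : ℕ) where
  C : Set (EuclideanSpace ℝ (Fin n))
  F : EuclideanSpace ℝ (Fin n) → Set (EuclideanSpace ℝ (Fin n))
  D : Set (EuclideanSpace ℝ (Fin n))
  G : EuclideanSpace ℝ (Fin n) → Set (EuclideanSpace ℝ (Fin n))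

/-- Outer semicontinuity of a set-valued map relative to `S`, at every point of `S`. -/
def OuterSemicontinuousOn {n : ℕ}
    (M : EuclideanSpace ℝ (Fin n) → Set (EuclideanSpace ℝ (Fin n)))
    (S : Set (EuclideanSpace ℝ (Fin n))) : Prop :=
  ∀ x ∈ S, ∀ (u v : ℕ → EuclideanSpace ℝ (Fin n)) (y : EuclideanSpace ℝ (Fin n)),
    (∀ k, u k ∈ S) → (∀ k, v k ∈ M (u k)) →
    Tendsto u atTop (𝓝 x) → Tendsto v atTop (𝓝 y) → y ∈ M x

/-- Local boundedness of a set-valued map relative to `S`, at every point of `S`. -/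
def LocallyBoundedOn {n : ℕ}
    (M : EuclideanSpace ℝ (Fin n) → Set (EuclideanSpace ℝ (Fin n)))
    (S : Set (EuclideanSpace ℝ (Fin n))) : Prop :=
  ∀ x ∈ S, ∃ N ∈ 𝓝 x, Bornology.IsBounded (⋃ y ∈ N ∩ S, M y)

namespace HybridSystem

variable {n : ℕ}

/-- The additive `δ`-perturbation `H_δ`. -/
def perturb (H : HybridSystem n) (δ : ℝ) : HybridSystem n where
  C := H.C + Metric.closedBall 0 δ
  F := fun x => H.F x + Metric.closedBall 0 δ
  D := H.D + Metric.closedBall 0 δ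
  G := fun x => H.G x + Metric.closedBall 0 δ

/-- The hybrid basic conditions. -/
structure BasicConditions (H : HybridSystem n) : Prop where
  isClosed_C : IsClosed H.C
  isClosed_D : IsClosed H.D
  osc_F : OuterSemicontinuousOn H.F H.C
  locallyBounded_F : LocallyBoundedOn H.F H.C
  convex_F : ∀ x ∈ H.C, Convex ℝ (H.F x)
  osc_G : OuterSemicontinuousOn H.G H.D
  locallyBounded_G : LocallyBoundedOn H.G H.D

structure IsSolution (H : HybridSystem n) (φ : HybridArc n) : Prop where
  init : φ.val 0 0 ∈ closure H.C ∪ H.D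
  flow_mem : ∀ (j : ℕ) (t : ℝ), t ∈ interior (φ.flowInterval j) → φ.val t j ∈ H.C
  flow_deriv : ∀ j : ℕ, (interior (φ.flowInterval j)).Nonempty →
    ∀ᵐ t ∂(volume.restrict (φ.flowInterval j)),
      ∃ v ∈ H.F (φ.val t j), HasDerivAt (fun s => φ.val s j) v t
  jump : ∀ (t : ℝ) (j : ℕ), (t, j) ∈ φ.dom → (t, j + 1) ∈ φ.dom →
    φ.val t j ∈ H.D ∧ φ.val t (j + 1) ∈ H.G (φ.val t j)

/-- A solution that has no proper extension to a solution. -/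
def IsMaximalSolution (H : HybridSystem n) (φ : HybridArc n) : Prop :=
  H.IsSolution φ ∧
    ¬ ∃ ψ : HybridArc n, H.IsSolution ψ ∧ φ.dom ⊂ ψ.dom ∧
      ∀ (t : ℝ) (j : ℕ), (t, j) ∈ φ.dom → φ.val t j = ψ.val t j

/-- The set of all maximal solutions starting from `K`. -/
def maximalSolutionsFrom (H : HybridSystem n) (K : Set (EuclideanSpace ℝ (Fin n))) :
    Set (HybridArc n) :=
  {φ | H.IsMaximalSolution φ ∧ φ.val 0 0 ∈ K}

/-- The set of points reached from `K` by maximal solutions at hybrid times `t + j ≥ T`. -/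
def reachableFrom (H : HybridSystem n) (T : ℝ) (K : Set (EuclideanSpace ℝ (Fin n))) :
    Set (EuclideanSpace ℝ (Fin n)) :=
  {x | ∃ φ ∈ H.maximalSolutionsFrom K, ∃ (t : ℝ) (j : ℕ),
    (t, j) ∈ φ.dom ∧ T ≤ t + j ∧ x = φ.val t j}

/-- Uniform pre-asymptotic stability of a closed set. -/
structure UpAS (H : HybridSystem n) (A : Set (EuclideanSpace ℝ (Fin n))) : Prop where
  isClosed : IsClosed A
  uniformStability : ∀ ε : ℝ, 0 < ε → ∃ r : ℝ, 0 < r ∧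
    ∀ φ : HybridArc n, H.IsSolution φ →
      Metric.infEDist (φ.val 0 0) A < ENNReal.ofReal r →
      ∀ (t : ℝ) (j : ℕ), (t, j) ∈ φ.dom →
        Metric.infEDist (φ.val t j) A < ENNReal.ofReal ε
  uniformPreAttractivity : ∃ ρ : ℝ, 0 < ρ ∧ ∀ ε : ℝ, 0 < ε → ∃ T : ℝ, 0 < T ∧
    ∀ φ : HybridArc n, H.IsSolution φ →
      Metric.infEDist (φ.val 0 0) A < ENNReal.ofReal ρ →
      ∀ (t : ℝ) (j : ℕ), (t, j) ∈ φ.dom → T ≤ t + j →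
        Metric.infEDist (φ.val t j) A < ENNReal.ofReal ε

/-- The basin of pre-attraction of `A`. -/
def basin (H : HybridSystem n) (A : Set (EuclideanSpace ℝ (Fin n))) :
    Set (EuclideanSpace ℝ (Fin n)) :=
  {x | ∀ φ : HybridArc n, H.IsSolution φ → φ.val 0 0 = x →
    φ.IsBounded ∧ (φ.IsComplete → φ.ConvergesTo A)}

/-- Safety with respect to `U` for the maximal solutions from `X₀`. -/
def IsSafe (H : HybridSystem n) (X₀ U : Set (EuclideanSpace ℝ (Fin n))) : Prop :=
  ∀ φ ∈ H.maximalSolutionsFrom X₀, φ.rge ∩ U = ∅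

structure StabilityWithSafety (H : HybridSystem n)
    (X₀ U A : Set (EuclideanSpace ℝ (Fin n))) : Prop where
  upAS : H.UpAS A
  subset_basin : X₀ ⊆ H.basin A
  safe : H.IsSafe X₀ U

structure ReachAvoidStay (H : HybridSystem n)
    (X₀ U Γ : Set (EuclideanSpace ℝ (Fin n))) : Prop where
  reach_stay : ∃ T : ℝ, 0 ≤ T ∧ H.reachableFrom T X₀ ⊆ Γ
  safe : H.IsSafe X₀ U

end HybridSystem

/-! Safety is common to both specifications, and for compact `A` the set `A + εB` is a closed
thickening. So everything rests on attraction being uniform over `X₀`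
(`UpAS.exists_time_forall_infEDist_lt`), which is a compactness argument. If it failed, there would
be solutions from `X₀` that are still `ε`-far from `A` at hybrid times of length at least `k`, for
every `k`. Their limit along an ultrafilter is a complete solution from `X₀`; being in the basin, it
comes within the stability radius of `A`. Then so does one of the approximating solutions, before
its bad time, and uniform stability keeps it `ε`-close from there on, a contradiction.

The work lies in the limit (`exists_limit`). Jump times converge in `EReal`. Where flows are
uniformly bounded, local boundedness of `F` makes them equi-Lipschitz. The differential inclusion
survives because average slopes lie in closed convex thickenings of `F x` (`slope_mem`,
`mem_of_hasDerivAt_flowLimit`), and the jumps survive because `G` has closed graph over `D`.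

Uniform bounds come from `bddUpTo`. Below a first blow-up time the limit is a solution from `X₀`,
hence bounded by the definition of the basin, which covers incomplete solutions too; a speed bound
then carries the estimate past that time. -/

/-! ### Mean value estimates for absolutely continuous curves. -/

theorem AbsolutelyContinuousOnInterval.clm_comp {V W : Type*} [NormedAddCommGroup V]
    [NormedSpace ℝ V] [NormedAddCommGroup W] [NormedSpace ℝ W] {f : ℝ → V} {a b : ℝ}
    (hf : AbsolutelyContinuousOnInterval f a b) (L : V →L[ℝ] W) :
    AbsolutelyContinuousOnInterval (fun t => L (f t)) a b := by
  refine squeeze_zero (fun t ↦ Finset.sum_nonneg fun i _ ↦ dist_nonneg) (fun t ↦ ?_)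
    (by simpa using Tendsto.const_mul ‖L‖ hf)
  rw [Finset.mul_sum]
  exact Finset.sum_le_sum fun i _ => L.lipschitz.dist_le_mul _ _

/-- Mean value theorem: if the derivative of an absolutely continuous function lies almost
everywhere in a closed convex set, then so does its average slope. -/
theorem AbsolutelyContinuousOnInterval.slope_mem {V : Type*} [NormedAddCommGroup V]
    [NormedSpace ℝ V] {f : ℝ → V} {a b : ℝ} (hf : AbsolutelyContinuousOnInterval f a b)
    (hab : a < b) {K : Set V} (hK : Convex ℝ K) (hKc : IsClosed K)
    (hd : ∀ᵐ t : ℝ, t ∈ Ioo a b → ∃ v ∈ K, HasDerivAt f v t) :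
    (b - a)⁻¹ • (f b - f a) ∈ K := by
  by_contra hx
  -- A functional separating the slope from `K` reduces the claim to integrating a scalar derivative
  -- that is a.e. below `u`.
  obtain ⟨L, u, hL, hu⟩ := geometric_hahn_banach_closed_point hK hKc hx
  have hg := hf.clm_comp L
  have hle : ∫ t in a..b, deriv (fun t => L (f t)) t ≤ ∫ _ in a..b, u := by
    refine intervalIntegral.integral_mono_ae_restrict hab.le hg.intervalIntegrable_deriv
      intervalIntegrable_const ?_
    rw [← restrict_Ioo_eq_restrict_Icc]
    refine (ae_restrict_iff' measurableSet_Ioo).2 (hd.mono fun t ht hmem => ?_)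
    obtain ⟨v, hv, hfv⟩ := ht hmem
    have := (L.hasFDerivAt.comp_hasDerivAt t hfv).deriv
    simp only [Function.comp_def] at this
    rw [this]
    exact (hL v hv).le
  rw [hg.integral_deriv_eq_sub, intervalIntegral.integral_const, smul_eq_mul] at hle
  have hba : 0 < b - a := sub_pos.2 hab
  rw [map_smul, map_sub, smul_eq_mul, lt_inv_mul_iff₀ hba] at hu
  linarith

theorem AbsolutelyContinuousOnInterval.norm_sub_le {V : Type*} [NormedAddCommGroup V]
    [NormedSpace ℝ V] {f : ℝ → V} {a b M : ℝ} (hf : AbsolutelyContinuousOnInterval f a b)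
    (hab : a ≤ b) (hd : ∀ᵐ t : ℝ, t ∈ Ioo a b → ∃ v, ‖v‖ ≤ M ∧ HasDerivAt f v t) :
    ‖f b - f a‖ ≤ M * (b - a) := by
  rcases hab.eq_or_lt with rfl | hab
  · simp
  have := hf.slope_mem hab (convex_closedBall 0 M) Metric.isClosed_closedBall
    (by simpa using hd)
  have hba : 0 < b - a := sub_pos.2 hab
  rw [mem_closedBall_zero_iff, norm_smul, norm_inv, Real.norm_of_nonneg hba.le,
    inv_mul_le_iff₀ hba] at this
  linarith

/-! ### Outer semicontinuous and locally bounded set-valued maps. -/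

section SetValued

variable {n : ℕ} {M : EuclideanSpace ℝ (Fin n) → Set (EuclideanSpace ℝ (Fin n))}
  {S : Set (EuclideanSpace ℝ (Fin n))}

theorem OuterSemicontinuousOn.isClosed_graph (hM : OuterSemicontinuousOn M S) (hS : IsClosed S) :
    IsClosed {p : EuclideanSpace ℝ (Fin n) × EuclideanSpace ℝ (Fin n) | p.1 ∈ S ∧ p.2 ∈ M p.1} := by
  refine IsSeqClosed.isClosed fun p q hp hq => ?_
  have h1 : Tendsto (fun k => (p k).1) atTop (𝓝 q.1) := (continuous_fst.tendsto q).comp hq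
  have h2 : Tendsto (fun k => (p k).2) atTop (𝓝 q.2) := (continuous_snd.tendsto q).comp hq
  have hqS : q.1 ∈ S := hS.mem_of_tendsto h1 (Eventually.of_forall fun k => (hp k).1)
  exact ⟨hqS, hM _ hqS _ _ _ (fun k => (hp k).1) (fun k => (hp k).2) h1 h2⟩

theorem OuterSemicontinuousOn.isClosed_apply (hM : OuterSemicontinuousOn M S) {x}
    (hx : x ∈ S) : IsClosed (M x) :=
  IsSeqClosed.isClosed fun _ _ hv hy =>
    hM x hx (fun _ => x) _ _ (fun _ => hx) hv tendsto_const_nhds hy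

theorem LocallyBoundedOn.exists_bound (hM : LocallyBoundedOn M S) (hS : IsClosed S) (R : ℝ) :
    ∃ B : ℝ, 0 < B ∧ ∀ x ∈ S, ‖x‖ ≤ R → ∀ v ∈ M x, ‖v‖ ≤ B := by
  have hK : IsCompact (Metric.closedBall 0 R ∩ S) := (isCompact_closedBall _ _).inter_right hS
  have : Bornology.IsBounded (⋃ y ∈ Metric.closedBall 0 R ∩ S, M y) := by
    refine hK.induction_on (p := fun T => Bornology.IsBounded (⋃ y ∈ T, M y)) (by simp)
      (fun s t hst ht => ht.subset (biUnion_subset_biUnion_left hst))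
      (fun s t hs ht => by rw [biUnion_union]; exact hs.union ht) (fun x hx => ?_)
    obtain ⟨N, hN, hb⟩ := hM x hx.2
    refine ⟨N ∩ (Metric.closedBall 0 R ∩ S), ?_, hb.subset ?_⟩
    · exact inter_mem (mem_nhdsWithin_of_mem_nhds hN) self_mem_nhdsWithin
    · exact biUnion_subset_biUnion_left fun y hy => ⟨hy.1, hy.2.2⟩
  obtain ⟨B, hB0, hB⟩ := this.exists_pos_norm_le
  exact ⟨B, hB0, fun x hx hxR v hv =>
    hB v (mem_biUnion (show x ∈ _ ∩ S from ⟨by simpa using hxR, hx⟩) hv)⟩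

/-- Near a point of `S`, the values of an outer semicontinuous and locally bounded map are close
to its value at the point. -/
theorem OuterSemicontinuousOn.eventually_subset_cthickening (hM : OuterSemicontinuousOn M S)
    (hb : LocallyBoundedOn M S) {x} (hx : x ∈ S) {η : ℝ} (hη : 0 < η) :
    ∃ γ > 0, ∀ y ∈ S, dist y x < γ → M y ⊆ Metric.cthickening η (M x) := by
  by_contra! hcon
  have hpos : ∀ k : ℕ, (0 : ℝ) < 1 / (k + 1) := fun k => by positivity
  choose u huS hux hu using fun k : ℕ => hcon _ (hpos k)
  simp only [not_subset] at hu
  choose v hv hvn using hu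
  have hux' : Tendsto u atTop (𝓝 x) := by
    rw [tendsto_iff_dist_tendsto_zero]
    exact squeeze_zero (fun _ => dist_nonneg) (fun k => (hux k).le)
      tendsto_one_div_add_atTop_nhds_zero_nat
  obtain ⟨N, hN, hNb⟩ := hb x hx
  have hfreq : ∃ᶠ k in atTop, v k ∈ ⋃ y ∈ N ∩ S, M y :=
    ((hux'.eventually hN).mono fun k hk =>
      mem_biUnion (show u k ∈ N ∩ S from ⟨hk, huS k⟩) (hv k)).frequently
  obtain ⟨y, _, φ, hφ, hy⟩ := tendsto_subseq_of_frequently_bounded hNb hfreq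
  have hyM := hM x hx _ _ y (fun k => huS (φ k)) (fun k => hv (φ k))
    (hux'.comp hφ.tendsto_atTop) hy
  have : ∀ᶠ k in atTop, v (φ k) ∈ Metric.cthickening η (M x) :=
    hy.eventually (mem_of_superset (Metric.ball_mem_nhds y hη) fun z hz =>
      Metric.mem_cthickening_of_dist_le z y η _ hyM (Metric.mem_ball.1 hz).le)
  obtain ⟨k, hk⟩ := this.exists
  exact hvn _ hk

end SetValued

/-! ### Flows on compact intervals. -/

namespace HybridSystem

variable {n : ℕ} {H : HybridSystem n}

/-- `f` is a flow of `H` on the compact interval `[a, b]`. -/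
structure IsFlow (H : HybridSystem n) (f : ℝ → EuclideanSpace ℝ (Fin n)) (a b : ℝ) : Prop where
  ac : AbsolutelyContinuousOnInterval f a b
  mem : ∀ t ∈ Ioo a b, f t ∈ H.C
  deriv : ∀ᵐ t : ℝ, t ∈ Ioo a b → ∃ v ∈ H.F (f t), HasDerivAt f v t

namespace IsFlow

variable {f : ℝ → EuclideanSpace ℝ (Fin n)} {a b c d : ℝ}

theorem mono (hf : H.IsFlow f a b) (hac : a ≤ c) (hcd : c ≤ d) (hdb : d ≤ b) :
    H.IsFlow f c d where
  ac := hf.ac.mono (by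
    rw [uIcc_of_le hcd, uIcc_of_le (hac.trans (hcd.trans hdb))]; exact Icc_subset_Icc hac hdb)
  mem t ht := hf.mem t (Ioo_subset_Ioo hac hdb ht)
  deriv := hf.deriv.mono fun _ h ht => h (Ioo_subset_Ioo hac hdb ht)

theorem continuousOn (hf : H.IsFlow f a b) (hab : a ≤ b) : ContinuousOn f (Icc a b) := by
  simpa [uIcc_of_le hab] using hf.ac.continuousOn

theorem norm_sub_le (hf : H.IsFlow f a b) {R M : ℝ}
    (hM : ∀ x ∈ H.C, ‖x‖ ≤ R → ∀ v ∈ H.F x, ‖v‖ ≤ M)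
    (hR : ∀ t ∈ Ioo a b, ‖f t‖ ≤ R) (hac : a ≤ c) (hcd : c ≤ d) (hdb : d ≤ b) :
    ‖f d - f c‖ ≤ M * (d - c) := by
  refine (hf.mono hac hcd hdb).ac.norm_sub_le hcd ?_
  filter_upwards [hf.deriv] with t ht htm
  have htm := Ioo_subset_Ioo hac hdb htm
  obtain ⟨v, hv, hfv⟩ := ht htm
  exact ⟨v, hM _ (hf.mem t htm) (hR t htm) v hv, hfv⟩

/-- A flow needs some time to leave a ball. -/
theorem norm_le_add_one (hf : H.IsFlow f a b) (hab : a ≤ b) {R M : ℝ} (hM0 : 0 < M)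
    (hM : ∀ x ∈ H.C, ‖x‖ ≤ R + 1 → ∀ v ∈ H.F x, ‖v‖ ≤ M) (ha : ‖f a‖ ≤ R)
    (hb : M * (b - a) < 1) : ∀ t ∈ Icc a b, ‖f t‖ ≤ R + 1 := by
  have hcont := (hf.continuousOn hab).norm
  by_contra! hcon
  obtain ⟨t₁, ht₁, hbig⟩ := hcon
  have hsub : Icc a t₁ ⊆ Icc a b := Icc_subset_Icc_right ht₁.2
  -- the first time at which the norm reaches `R + 1`
  have hne : (Icc a t₁ ∩ (fun t => ‖f t‖) ⁻¹' {R + 1}).Nonempty := by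
    obtain ⟨s, hs, hs'⟩ := intermediate_value_Icc ht₁.1 (hcont.mono hsub)
      (show R + 1 ∈ Icc (‖f a‖) (‖f t₁‖) from ⟨by linarith, hbig.le⟩)
    exact ⟨s, hs, hs'⟩
  have hcomp : IsCompact (Icc a t₁ ∩ (fun t => ‖f t‖) ⁻¹' {R + 1}) :=
    isCompact_Icc.of_isClosed_subset
      ((hcont.mono hsub).preimage_isClosed_of_isClosed isClosed_Icc isClosed_singleton)
      inter_subset_left
  obtain ⟨s, ⟨hs, hsR⟩, hmin⟩ := hcomp.exists_isLeast hne
  have hsb := hsub hs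
  have hin : ∀ t ∈ Ioo a s, ‖f t‖ ≤ R + 1 := by
    intro t ht
    by_contra! htR
    obtain ⟨w, hw, hw'⟩ := intermediate_value_Icc ht.1.le
      (hcont.mono (Icc_subset_Icc_right (ht.2.le.trans hsb.2)))
      (show R + 1 ∈ Icc (‖f a‖) (‖f t‖) from ⟨by linarith, htR.le⟩)
    have := hmin ⟨⟨hw.1, hw.2.trans (ht.2.le.trans hs.2)⟩, hw'⟩
    linarith [hw.2, ht.2]
  have h := (hf.mono le_rfl hsb.1 hsb.2).norm_sub_le hM hin le_rfl hsb.1 le_rfl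
  have h2 : ‖f s‖ - ‖f a‖ ≤ ‖f s - f a‖ := norm_sub_norm_le _ _
  have h3 : M * (s - a) ≤ M * (b - a) := by
    have := hsb.2
    gcongr
  have hsR' : ‖f s‖ = R + 1 := hsR
  linarith

end IsFlow

end HybridSystem

/-- Truncation of a real number to the interval `[a, b]`. -/
def clampIcc (a b t : ℝ) : ℝ := max a (min t b)

theorem clampIcc_mem {a b : ℝ} (h : a ≤ b) (t : ℝ) : clampIcc a b t ∈ Icc a b :=
  ⟨le_max_left _ _, max_le h (min_le_right _ _)⟩

theorem clampIcc_of_mem {a b t : ℝ} (h : t ∈ Icc a b) : clampIcc a b t = t := by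
  rw [clampIcc, min_eq_left h.2, max_eq_right h.1]

theorem clampIcc_le {a b t T : ℝ} (ha : a ≤ T) (ht : t ≤ T) : clampIcc a b t ≤ T :=
  max_le ha ((min_le_left _ _).trans ht)

theorem abs_clampIcc_sub_le (a b s t : ℝ) : |clampIcc a b s - clampIcc a b t| ≤ |s - t| := by
  refine (abs_max_sub_max_le_max _ _ _ _).trans ?_
  refine max_le (by simp) ((abs_min_sub_min_le_max _ _ _ _).trans (max_le le_rfl (by simp)))

/-! ### Ultrafilter limits of flows on varying intervals. -/

section FlowLimit

variable {n : ℕ} {H : HybridSystem n} {𝒰 : Ultrafilter ℕ}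
  {f : ℕ → ℝ → EuclideanSpace ℝ (Fin n)} {α β : ℕ → ℝ}

/-- The functions `f k` on `[α k, β k]` are uniformly bounded up to time `T`, for almost all `k`. -/
def BoundedUpTo (𝒰 : Ultrafilter ℕ) (f : ℕ → ℝ → EuclideanSpace ℝ (Fin n)) (α β : ℕ → ℝ)
    (T : ℝ) : Prop :=
  ∃ R : ℝ, ∀ᶠ k in 𝒰, ∀ s ∈ Icc (α k) (β k), s ≤ T → ‖f k s‖ ≤ R

theorem BoundedUpTo.mono {S T : ℝ} (h : BoundedUpTo 𝒰 f α β T) (hST : S ≤ T) :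
    BoundedUpTo 𝒰 f α β S :=
  h.imp fun _ hR => hR.mono fun _ hk s hs hsS => hk s hs (hsS.trans hST)

/-- The pointwise limit along an ultrafilter of functions on intervals, extended by constants. -/
noncomputable def flowLimit (𝒰 : Ultrafilter ℕ) (f : ℕ → ℝ → EuclideanSpace ℝ (Fin n))
    (α β : ℕ → ℝ) (t : ℝ) : EuclideanSpace ℝ (Fin n) :=
  limUnder (𝒰 : Filter ℕ) fun k => f k (clampIcc (α k) (β k) t)

/-- Closed balls are compact, so an ultrafilter makes every bounded sequence converge; no
subsequences need to be extracted. -/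
theorem Ultrafilter.tendsto_limUnder_of_bounded {x : ℕ → EuclideanSpace ℝ (Fin n)} {R : ℝ}
    (h : ∀ᶠ k in 𝒰, ‖x k‖ ≤ R) : Tendsto x 𝒰 (𝓝 (limUnder (𝒰 : Filter ℕ) x)) := by
  obtain ⟨y, _, hy⟩ := (isCompact_closedBall (0 : EuclideanSpace ℝ (Fin n)) R).ultrafilter_le_nhds
    (𝒰.map x) (le_principal_iff.2 (h.mono fun k hk => mem_closedBall_zero_iff.2 hk))
  exact tendsto_nhds_limUnder ⟨y, hy⟩

variable (hf : ∀ᶠ k in 𝒰, α k ≤ β k ∧ H.IsFlow (f k) (α k) (β k))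

include hf

theorem tendsto_flowLimit {T t : ℝ} (hT : BoundedUpTo 𝒰 f α β T) (hα : ∀ᶠ k in 𝒰, α k ≤ T)
    (ht : t ≤ T) : Tendsto (fun k => f k (clampIcc (α k) (β k) t)) 𝒰
      (𝓝 (flowLimit 𝒰 f α β t)) := by
  obtain ⟨R, hR⟩ := hT
  refine Ultrafilter.tendsto_limUnder_of_bounded (R := R) ?_
  filter_upwards [hR, hf, hα] with k hk hfk hαk
  exact hk _ (clampIcc_mem hfk.1 t) (clampIcc_le hαk ht)

/-- A common bound on positions confines the flows to a ball, over which `F` is bounded; this gives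
a common speed bound. -/
theorem BoundedUpTo.exists_lipschitz {T : ℝ} (hH : H.BasicConditions)
    (hT : BoundedUpTo 𝒰 f α β T) :
    ∃ M : ℝ, 0 < M ∧ ∀ᶠ k in 𝒰, ∀ s ∈ Icc (α k) (β k), ∀ t ∈ Icc (α k) (β k), s ≤ T → t ≤ T →
      ‖f k t - f k s‖ ≤ M * |t - s| := by
  obtain ⟨R, hR⟩ := hT
  obtain ⟨M, hM0, hM⟩ := hH.locallyBounded_F.exists_bound hH.isClosed_C R
  refine ⟨M, hM0, ?_⟩
  filter_upwards [hR, hf] with k hk hfk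
  have key : ∀ s ∈ Icc (α k) (β k), ∀ t ∈ Icc (α k) (β k), t ≤ T → s ≤ t →
      ‖f k t - f k s‖ ≤ M * (t - s) := by
    intro s hs t ht htT hst
    refine (hfk.2.mono hs.1 hst ht.2).norm_sub_le hM (fun w hw => ?_) le_rfl hst le_rfl
    exact hk w ⟨hs.1.trans hw.1.le, hw.2.le.trans ht.2⟩ (hw.2.le.trans htT)
  intro s hs t ht hsT htT
  rcases le_total s t with h | h
  · rw [abs_of_nonneg (sub_nonneg.2 h)]
    exact key s hs t ht htT h
  · rw [norm_sub_rev, abs_sub_comm, abs_of_nonneg (sub_nonneg.2 h)]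
    exact key t ht s hs hsT h

/-- Equicontinuity allows the evaluation time to vary with `k`. This is needed at jumps, whose times
differ from one solution to the next. -/
theorem tendsto_flowLimit_of_tendsto {T t : ℝ} (hH : H.BasicConditions)
    (hT : BoundedUpTo 𝒰 f α β T) (hα : ∀ᶠ k in 𝒰, α k ≤ T) (ht : t < T) {u : ℕ → ℝ}
    (hu : Tendsto u 𝒰 (𝓝 t)) :
    Tendsto (fun k => f k (clampIcc (α k) (β k) (u k))) 𝒰 (𝓝 (flowLimit 𝒰 f α β t)) := by
  obtain ⟨M, hM0, hM⟩ := hT.exists_lipschitz hf hH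
  have h0 : Tendsto (fun k => M * |u k - t|) 𝒰 (𝓝 0) := by
    have : Tendsto (fun k => M * |u k - t|) 𝒰 (𝓝 (M * |t - t|)) :=
      ((hu.sub_const t).abs).const_mul M
    simpa using this
  have h1 : Tendsto (fun k => f k (clampIcc (α k) (β k) (u k)) - f k (clampIcc (α k) (β k) t))
      𝒰 (𝓝 0) := by
    refine squeeze_zero_norm' ?_ h0
    filter_upwards [hM, hf, hα, hu.eventually (gt_mem_nhds ht)] with k hk hfk hαk huk
    refine (hk _ (clampIcc_mem hfk.1 _) _ (clampIcc_mem hfk.1 _) (clampIcc_le hαk ht.le)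
      (clampIcc_le hαk huk.le)).trans ?_
    exact mul_le_mul_of_nonneg_left (abs_clampIcc_sub_le _ _ _ _) hM0.le
  simpa using h1.add (tendsto_flowLimit hf hT hα ht.le)

theorem exists_lipschitzOnWith_flowLimit {T : ℝ} (hH : H.BasicConditions)
    (hT : BoundedUpTo 𝒰 f α β T) (hα : ∀ᶠ k in 𝒰, α k ≤ T) :
    ∃ M, LipschitzOnWith M (flowLimit 𝒰 f α β) (Iic T) := by
  obtain ⟨M, hM0, hM⟩ := hT.exists_lipschitz hf hH
  refine ⟨M.toNNReal, LipschitzOnWith.of_dist_le_mul fun s hs t ht => ?_⟩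
  refine le_of_tendsto ((tendsto_flowLimit hf hT hα hs).dist (tendsto_flowLimit hf hT hα ht)) ?_
  filter_upwards [hM, hf, hα] with k hk hfk hαk
  rw [dist_eq_norm, Real.coe_toNNReal _ hM0.le, Real.dist_eq]
  refine (hk _ (clampIcc_mem hfk.1 _) _ (clampIcc_mem hfk.1 _) (clampIcc_le hαk ht)
      (clampIcc_le hαk hs)).trans ?_
  exact mul_le_mul_of_nonneg_left (abs_clampIcc_sub_le _ _ _ _) hM0.le

theorem flowLimit_mem {T t : ℝ} (hH : H.BasicConditions) (hT : BoundedUpTo 𝒰 f α β T)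
    (ht : t ≤ T) (hαβ : ∀ᶠ k in 𝒰, t ∈ Ioo (α k) (β k)) : flowLimit 𝒰 f α β t ∈ H.C := by
  refine hH.isClosed_C.mem_of_tendsto
    (tendsto_flowLimit hf hT (hαβ.mono fun k hk => hk.1.le.trans ht) ht) ?_
  filter_upwards [hαβ, hf] with k hk hfk
  rw [clampIcc_of_mem (Ioo_subset_Icc_self hk)]
  exact hfk.2.mem t hk

/-- Differential inclusions pass to the limit. -/
theorem mem_of_hasDerivAt_flowLimit {T t t₂ : ℝ} {v : EuclideanSpace ℝ (Fin n)}
    (hH : H.BasicConditions) (hT : BoundedUpTo 𝒰 f α β T) (ht : t < T) (ht₂ : t < t₂)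
    (hαβ : ∀ᶠ k in 𝒰, α k < t ∧ t₂ < β k) (hv : HasDerivAt (flowLimit 𝒰 f α β) v t) :
    v ∈ H.F (flowLimit 𝒰 f α β t) := by
  have hα : ∀ᶠ k in 𝒰, α k ≤ T := hαβ.mono fun k hk => hk.1.le.trans ht.le
  have hC : flowLimit 𝒰 f α β t ∈ H.C :=
    flowLimit_mem hf hH hT ht.le (hαβ.mono fun k hk => ⟨hk.1, ht₂.trans hk.2⟩)
  set x := flowLimit 𝒰 f α β t
  have hcl := hH.osc_F.isClosed_apply hC
  -- As `F x` is closed, it suffices to place `v` in each closed `η`-thickening of it.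
  rw [← hcl.closure_eq, Metric.closure_eq_iInter_cthickening]
  refine mem_iInter₂.2 fun η hη => ?_
  obtain ⟨γ, hγ, hsub⟩ := hH.osc_F.eventually_subset_cthickening hH.locallyBounded_F hC hη
  obtain ⟨M, hM0, hM⟩ := hT.exists_lipschitz hf hH
  have hclose : ∀ᶠ k in 𝒰, dist (f k t) x < γ / 2 := by
    filter_upwards [(tendsto_flowLimit hf hT hα ht.le).eventually
      (Metric.ball_mem_nhds x (half_pos hγ)), hαβ] with k hk hk'
    rw [clampIcc_of_mem ⟨hk'.1.le, ht₂.le.trans hk'.2.le⟩] at hk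
    exact hk
  -- On `[t, t + h]` the `k`-th flow stays within `γ` of `x`: one half of `γ` pays for `f k t`, the
  -- other for motion at speed `M`.
  have hev : ∀ᶠ h : ℝ in 𝓝[>] 0, M * h < γ / 2 ∧ t + h < T ∧ t + h < t₂ ∧ 0 < h := by
    have h1 : ∀ᶠ h : ℝ in 𝓝 0, M * h < γ / 2 := by
      have : Tendsto (fun h : ℝ => M * h) (𝓝 0) (𝓝 (M * 0)) :=
        (continuous_const_mul M).tendsto 0
      rw [mul_zero] at this
      exact this.eventually (gt_mem_nhds (half_pos hγ))
    have h2 : Tendsto (fun h : ℝ => t + h) (𝓝 0) (𝓝 t) := by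
      simpa using (continuous_const_add t).tendsto 0
    filter_upwards [nhdsWithin_le_nhds h1, nhdsWithin_le_nhds (h2.eventually (gt_mem_nhds ht)),
      nhdsWithin_le_nhds (h2.eventually (gt_mem_nhds ht₂)), self_mem_nhdsWithin] with h a b c d
    exact ⟨a, b, c, d⟩
  refine (Metric.isClosed_cthickening).mem_of_tendsto hv.tendsto_slope_zero_right ?_
  filter_upwards [hev] with h ⟨hMh, hhT, hht, hh0⟩
  have hlim : Tendsto (fun k => h⁻¹ • (f k (clampIcc (α k) (β k) (t + h)) -
      f k (clampIcc (α k) (β k) t))) 𝒰 (𝓝 (h⁻¹ • (flowLimit 𝒰 f α β (t + h) - x))) :=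
    ((tendsto_flowLimit hf hT hα hhT.le).sub (tendsto_flowLimit hf hT hα ht.le)).const_smul _
  refine Metric.isClosed_cthickening.mem_of_tendsto hlim ?_
  filter_upwards [hf, hαβ, hM, hclose] with k hfk hk hMk hck
  have hmem : ∀ s ∈ Icc t (t + h), s ∈ Icc (α k) (β k) := fun s hs =>
    ⟨hk.1.le.trans hs.1, hs.2.trans (hht.le.trans hk.2.le)⟩
  have htt : t ∈ Icc t (t + h) := ⟨le_rfl, by linarith⟩
  have hth : t + h ∈ Icc t (t + h) := ⟨by linarith, le_rfl⟩
  rw [clampIcc_of_mem (hmem _ htt), clampIcc_of_mem (hmem _ hth)]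
  have hfl := hfk.2.mono hk.1.le hth.1 (hmem _ hth).2
  -- Convexity of `F x` enters here: its thickening is convex, so it contains the average slope
  -- along with the velocities.
  have := hfl.ac.slope_mem (by linarith) ((hH.convex_F x hC).cthickening η)
    Metric.isClosed_cthickening ?_
  · simpa using this
  filter_upwards [hfl.deriv] with s hs hsm
  obtain ⟨w, hw, hfw⟩ := hs hsm
  refine ⟨w, hsub _ (hfl.mem s hsm) ?_ hw, hfw⟩
  have h1 := hMk t (hmem _ htt) s (hmem _ (Ioo_subset_Icc_self hsm)) ht.le
    (hsm.2.le.trans hhT.le)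
  rw [abs_of_pos (sub_pos.2 hsm.1), ← dist_eq_norm] at h1
  have h2 : M * (s - t) ≤ M * h := by
    have := hsm.2
    gcongr
    linarith
  linarith [dist_triangle (f k s) (f k t) x]

/-- The limit is Lipschitz on each admissible half-line, hence a.e. differentiable there. Rational
right ends keep the number of null sets countable. -/
theorem ae_differentiableAt_flowLimit (hH : H.BasicConditions) :
    ∀ᵐ t : ℝ, ∀ T, t < T → BoundedUpTo 𝒰 f α β T → (∀ᶠ k in 𝒰, α k < t) →
      DifferentiableAt ℝ (flowLimit 𝒰 f α β) t := by
  have key : ∀ q : ℚ, ∀ᵐ t : ℝ, t < q → BoundedUpTo 𝒰 f α β q → (∀ᶠ k in 𝒰, α k < q) →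
      DifferentiableAt ℝ (flowLimit 𝒰 f α β) t := by
    intro q
    by_cases hq : BoundedUpTo 𝒰 f α β q ∧ ∀ᶠ k in 𝒰, α k < q
    · obtain ⟨M, hM⟩ := exists_lipschitzOnWith_flowLimit hf hH hq.1
        (hq.2.mono fun _ h => h.le)
      filter_upwards [hM.ae_differentiableWithinAt_of_mem_real] with t ht htq _ _
      exact (ht htq.le).differentiableAt (Iic_mem_nhds htq)
    · exact Eventually.of_forall fun t _ h1 h2 => absurd ⟨h1, h2⟩ hq
  filter_upwards [ae_all_iff.2 key] with t ht T htT hT hα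
  obtain ⟨q, hq1, hq2⟩ := exists_rat_btwn htT
  exact ht q hq1 (hT.mono hq2.le) (hα.mono fun k hk => hk.trans hq1)

end FlowLimit

/-! ### Jump times and tails of hybrid time domains. -/

namespace IsHybridTimeDomain

variable {E : Set (ℝ × ℕ)}

theorem zero_mem (hE : IsHybridTimeDomain E) : ((0 : ℝ), 0) ∈ E := by
  obtain ⟨t, t0, tm, rfl | ⟨J, I, hI, rfl⟩⟩ := hE
  · exact ⟨t0.le, t0 ▸ tm (Nat.zero_le 1)⟩
  · have h01 : (0 : ℝ) ≤ t 1 := t0 ▸ tm (Nat.zero_le 1)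
    rcases Nat.eq_zero_or_pos J with rfl | hJ
    · refine Or.inr ⟨rfl, ?_⟩
      rcases hI with rfl | ⟨hlt, rfl⟩ | rfl
      · exact ⟨t0.le, h01⟩
      · exact ⟨t0.le, t0 ▸ hlt⟩
      · exact t0.le
    · exact Or.inl ⟨hJ, t0.le, h01⟩

theorem measurableSet_section (hE : IsHybridTimeDomain E) (j : ℕ) :
    MeasurableSet {t : ℝ | (t, j) ∈ E} := by
  obtain ⟨t, t0, tm, rfl | ⟨J, I, hI, rfl⟩⟩ := hE
  · exact (measurableSet_Icc : MeasurableSet (Icc (t j) (t (j + 1))))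
  · have hIm : MeasurableSet I := by
      rcases hI with rfl | ⟨_, rfl⟩ | rfl
      · exact measurableSet_Icc
      · exact measurableSet_Ico
      · exact measurableSet_Ici
    have : MeasurableSet ({s : ℝ | j < J} ∩ Icc (t j) (t (j + 1)) ∪ {s : ℝ | j = J} ∩ I) :=
      ((MeasurableSet.const _).inter measurableSet_Icc).union ((MeasurableSet.const _).inter hIm)
    exact this

/-- The jump times of a hybrid time domain up to one of its points. -/
theorem exists_jumpTimes (hE : IsHybridTimeDomain E) {τ : ℝ} {m : ℕ} (h : (τ, m) ∈ E) :
    ∃ a : ℕ → ℝ, Monotone a ∧ a 0 = 0 ∧ a (m + 1) = τ ∧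
      (∀ j ≤ m, ∀ s ∈ Icc (a j) (a (j + 1)), (s, j) ∈ E) ∧
      ∀ j ≤ m, ∀ s ≤ τ, (s, j) ∈ E → s ∈ Icc (a j) (a (j + 1)) := by
  -- Only the part of section `m` up to `τ` matters, so the different shapes of the last interval
  -- can be treated alike.
  have key : ∀ t : ℕ → ℝ, t 0 = 0 → Monotone t → t m ≤ τ →
      (∀ j < m, ∀ s, (s, j) ∈ E ↔ s ∈ Icc (t j) (t (j + 1))) →
      (∀ s ≤ τ, (s, m) ∈ E ↔ t m ≤ s) →
      ∃ a : ℕ → ℝ, Monotone a ∧ a 0 = 0 ∧ a (m + 1) = τ ∧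
        (∀ j ≤ m, ∀ s ∈ Icc (a j) (a (j + 1)), (s, j) ∈ E) ∧
        ∀ j ≤ m, ∀ s ≤ τ, (s, j) ∈ E → s ∈ Icc (a j) (a (j + 1)) := by
    intro t t0 tm hτ h1 h2
    have ha : ∀ j ≤ m, (if j ≤ m then t j else τ) = t j := fun j hj => if_pos hj
    have ha' : ∀ j, m < j → (if j ≤ m then t j else τ) = τ := fun j hj => if_neg (not_le.2 hj)
    refine ⟨fun j => if j ≤ m then t j else τ, monotone_nat_of_le_succ fun j => ?_, by simp [t0],
      by simp, fun j hj s hs => ?_, fun j hj s hsτ hs => ?_⟩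
    · rcases lt_trichotomy j m with hj | rfl | hj
      · rw [ha j hj.le, ha _ (by omega)]
        exact tm (Nat.le_succ j)
      · simpa using hτ
      · rw [ha' j hj, ha' _ (by omega)]
    · rcases hj.eq_or_lt with rfl | hj
      · have hs : s ∈ Icc (t j) τ := by simpa using hs
        exact (h2 s hs.2).2 hs.1
      · simp only [ha j hj.le, ha (j + 1) hj] at hs
        exact (h1 j hj s).2 hs
    · rcases hj.eq_or_lt with rfl | hj
      · simpa using And.intro ((h2 s hsτ).1 hs) hsτ
      · simp only [ha j hj.le, ha (j + 1) hj]
        exact (h1 j hj s).1 hs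
  obtain ⟨t, t0, tm, rfl | ⟨J, I, hI, rfl⟩⟩ := hE
  · exact key t t0 tm h.1 (fun j _ s => Iff.rfl) fun s hs => ⟨fun h' => h'.1, fun h' =>
      ⟨h', hs.trans h.2⟩⟩
  · rcases h with ⟨hmJ, h⟩ | ⟨hmJ, h⟩
    · simp only at hmJ h
      refine key t t0 tm h.1 (fun j hj s => ?_) fun s hs => ?_
      · have h1 : j < J := hj.trans hmJ
        simp [h1, h1.ne]
      · simp only [mem_ofPred_eq, hmJ, hmJ.ne, mem_Icc, true_and, false_and, or_false,
          and_iff_left_iff_imp]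
        exact fun _ => hs.trans h.2
    · simp only at hmJ h
      subst hmJ
      refine key t t0 tm ?_ (fun j hj s => ?_) fun s hs => ?_
      · rcases hI with rfl | ⟨_, rfl⟩ | rfl
        exacts [h.1, h.1, h]
      · simp [hj, hj.ne]
      · simp only [mem_ofPred_eq, lt_irrefl, false_and, true_and, false_or]
        rcases hI with rfl | ⟨_, rfl⟩ | rfl
        · exact ⟨fun h' => h'.1, fun h' => ⟨h', hs.trans h.2⟩⟩
        · exact ⟨fun h' => h'.1, fun h' => ⟨h', hs.trans_lt h.2⟩⟩
        · exact Iff.rfl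

/-- The part of a hybrid time domain after one of its points is a hybrid time domain. -/
theorem tail (hE : IsHybridTimeDomain E) {p : ℝ} {i : ℕ} (h : (p, i) ∈ E) :
    IsHybridTimeDomain {q : ℝ × ℕ | 0 ≤ q.1 ∧ (q.1 + p, q.2 + i) ∈ E} := by
  -- The shifted jump times are cut off at `0` because `p` may lie inside the `i`-th interval. The
  -- hypothesis on `p` says that right ends are not affected by the cut.
  have hmem : ∀ (t : ℕ → ℝ) (s : ℝ) (j : ℕ), p ≤ t (j + 1 + i) →
      (0 ≤ s ∧ s + p ∈ Icc (t (j + i)) (t (j + i + 1)) ↔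
        s ∈ Icc (max 0 (t (j + i) - p)) (max 0 (t (j + 1 + i) - p))) := by
    intro t s j hp
    rw [max_eq_right (sub_nonneg.2 hp), add_right_comm j i 1, mem_Icc, mem_Icc, max_le_iff]
    constructor
    · rintro ⟨h0, h1, h2⟩
      exact ⟨⟨h0, by linarith⟩, by linarith⟩
    · rintro ⟨⟨h0, h1⟩, h2⟩
      exact ⟨h0, by linarith, by linarith⟩
  obtain ⟨t, t0, tm, rfl | ⟨J, I, hI, rfl⟩⟩ := hE
  · have hp : ∀ j, p ≤ t (j + 1 + i) := fun j => h.2.trans (tm (by simp only; omega))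
    refine ⟨fun j => max 0 (t (j + i) - p), ?_, ?_, Or.inl ?_⟩
    · simpa using h.1
    · intro j k hjk
      exact max_le_max le_rfl (sub_le_sub_right (tm (by omega)) p)
    · ext ⟨s, j⟩
      exact hmem t s j (hp j)
  · have hiJ : i ≤ J := by
      rcases h with ⟨h, -⟩ | ⟨h, -⟩
      exacts [h.le, h.le]
    have htp : t i ≤ p := by
      rcases h with ⟨_, h⟩ | ⟨h', h⟩
      · exact h.1
      · simp only at h' h
        subst h'
        rcases hI with rfl | ⟨_, rfl⟩ | rfl
        exacts [h.1, h.1, h]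
    have hp : ∀ j, j + i < J → p ≤ t (j + 1 + i) := by
      intro j hj
      rcases h with ⟨_, h⟩ | ⟨h', _⟩
      · exact h.2.trans (tm (by simp only; omega))
      · simp only at h'
        omega
    have hpJ : i < J → p ≤ t J := by
      intro hi
      have := hp (J - i - 1) (by omega)
      rwa [show J - i - 1 + 1 + i = J by omega] at this
    refine ⟨fun j => max 0 (t (j + i) - p), ?_, ?_, Or.inr ⟨J - i, {s | 0 ≤ s ∧ s + p ∈ I},
      ?_, ?_⟩⟩
    · simpa using htp
    · intro j k hjk
      exact max_le_max le_rfl (sub_le_sub_right (tm (by omega)) p)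
    · have e1 : J - i + i = J := by omega
      have e2 : J - i + 1 + i = J + 1 := by omega
      simp only [e1, e2]
      have hpI : i < J ∨ p ∈ I := by
        rcases h with ⟨h, _⟩ | ⟨_, h⟩
        exacts [Or.inl h, Or.inr h]
      rcases hI with rfl | ⟨hlt, rfl⟩ | rfl
      · left
        have hpJ1 : p ≤ t (J + 1) := by
          rcases hpI with hi | hi
          exacts [(hpJ hi).trans (tm (Nat.le_succ J)), hi.2]
        ext s
        have := hmem t s (J - i) (by rwa [e2])
        rwa [e1, e2] at this
      · right; left
        have hpJ1 : p < t (J + 1) := by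
          rcases hpI with hi | hi
          exacts [(hpJ hi).trans_lt hlt, hi.2]
        rw [max_eq_right (sub_nonneg.2 hpJ1.le)]
        refine ⟨max_lt (sub_pos.2 hpJ1) (by linarith), ?_⟩
        ext s
        simp only [mem_ofPred_eq, mem_Ico, max_le_iff, sub_le_iff_le_add, lt_sub_iff_add_lt,
          and_assoc]
      · right; right
        ext s
        simp only [mem_ofPred_eq, mem_Ici, max_le_iff, sub_le_iff_le_add]
    · ext ⟨s, j⟩
      simp only [mem_ofPred_eq]
      have e : j = J - i ↔ j + i = J := by omega
      have e' : j < J - i ↔ j + i < J := by omega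
      rw [e, e', and_or_left]
      refine or_congr ?_ ?_
      · by_cases hj : j + i < J
        · simp only [hj, true_and]
          exact hmem t s j (hp j hj)
        · simp [hj]
      · tauto

end IsHybridTimeDomain

/-! ### Truncations and tails of solutions. -/

namespace HybridSystem

variable {n : ℕ} {H : HybridSystem n}

theorem IsSolution.isFlow {φ : HybridArc n} (hφ : H.IsSolution φ) {j : ℕ} {a b : ℝ} (hab : a ≤ b)
    (h : ∀ s ∈ Icc a b, (s, j) ∈ φ.dom) : H.IsFlow (fun t => φ.val t j) a b := by
  have hint : Ioo a b ⊆ interior (φ.flowInterval j) :=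
    interior_maximal (fun s hs => h s (Ioo_subset_Icc_self hs)) isOpen_Ioo
  refine ⟨φ.locallyAC j a b (h a ⟨le_rfl, hab⟩) (h b ⟨hab, le_rfl⟩),
    fun t ht => hφ.flow_mem j t (hint ht), ?_⟩
  rcases (Ioo a b).eq_empty_or_nonempty with he | hne
  · simp [he]
  · refine (ae_restrict_iff' measurableSet_Ioo).1
      (ae_restrict_of_ae_restrict_of_subset ?_ (hφ.flow_deriv j (hne.mono hint)))
    exact fun s hs => h s (Ioo_subset_Icc_self hs)

/-- Every non-final point of a solution lies in `closure C ∪ D`. -/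
theorem IsSolution.mem_of_later {φ : HybridArc n} (hφ : H.IsSolution φ) {p τ : ℝ} {i m : ℕ}
    (hp : (p, i) ∈ φ.dom) (hτ : (τ, m) ∈ φ.dom) (hpτ : p ≤ τ) (him : i ≤ m)
    (hne : ¬ (p = τ ∧ i = m)) : φ.val p i ∈ closure H.C ∪ H.D := by
  have flow : ∀ b, p < b → (∀ s ∈ Icc p b, (s, i) ∈ φ.dom) →
      φ.val p i ∈ closure H.C ∪ H.D := by
    intro b hb h
    have hf := hφ.isFlow hb.le h
    left
    have hcont := ((hf.continuousOn hb.le) p ⟨le_rfl, hb.le⟩).mono Ioo_subset_Icc_self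
    refine hcont.mem_closure ?_ fun t ht => hf.mem t ht
    rw [closure_Ioo hb.ne]
    exact ⟨le_rfl, hb.le⟩
  obtain ⟨a, am, a0, aτ, h1, h2⟩ := φ.isHybridTimeDomain.exists_jumpTimes hτ
  have hpi := h2 i him p hpτ hp
  -- Either `p` ends its interval and a jump follows, which puts the point in `D`, or the solution
  -- flows on from `p`, which puts it in the closure of `C`.
  rcases hpi.2.eq_or_lt with hpa | hpa
  · have hi : i < m := lt_of_le_of_ne him fun h => hne ⟨by rw [hpa, h, aτ], h⟩
    refine Or.inr (hφ.jump p i hp (h1 (i + 1) hi p ?_)).1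
    rw [hpa]
    exact ⟨le_rfl, am (Nat.le_succ _)⟩
  · exact flow _ hpa fun s hs => h1 i him s ⟨hpi.1.trans hs.1, hs.2⟩

end HybridSystem

theorem AbsolutelyContinuousOnInterval.comp_add_right {V : Type*} [PseudoMetricSpace V]
    {f : ℝ → V} {a b p : ℝ} (hf : AbsolutelyContinuousOnInterval f (a + p) (b + p)) :
    AbsolutelyContinuousOnInterval (fun t => f (t + p)) a b := by
  rw [absolutelyContinuousOnInterval_iff] at hf ⊢
  intro ε hε
  obtain ⟨δ, hδ, h⟩ := hf ε hε
  refine ⟨δ, hδ, fun E hE hlt => ?_⟩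
  refine h ⟨E.1, fun i => ((E.2 i).1 + p, (E.2 i).2 + p)⟩ ⟨fun i hi => ?_, fun i hi k hk hik => ?_⟩
    (by simpa using hlt)
  · have h := hE.1 i hi
    simp only [← image_add_const_uIcc]
    exact ⟨mem_image_of_mem _ h.1, mem_image_of_mem _ h.2⟩
  · have h := hE.2 hi hk hik
    simp only [Function.onFun] at h ⊢
    have hu : ∀ x y : ℝ, uIoc (x + p) (y + p) = (fun t => t + p) '' uIoc x y := by
      intro x y
      simp [uIoc, min_add_add_right, max_add_add_right]
    rw [hu, hu]
    exact disjoint_image_of_injective (add_left_injective p) h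

namespace HybridArc

variable {n : ℕ}

/-- The part of a hybrid arc after a point of its domain. -/
def tail (φ : HybridArc n) (p : ℝ) (i : ℕ) (h : (p, i) ∈ φ.dom) : HybridArc n where
  dom := {q : ℝ × ℕ | 0 ≤ q.1 ∧ (q.1 + p, q.2 + i) ∈ φ.dom}
  val t j := φ.val (t + p) (j + i)
  isHybridTimeDomain := φ.isHybridTimeDomain.tail h
  locallyAC j _ _ ha hb := (φ.locallyAC (j + i) _ _ ha.2 hb.2).comp_add_right

end HybridArc

namespace HybridSystem

variable {n : ℕ} {H : HybridSystem n}

theorem IsSolution.tail {φ : HybridArc n} (hφ : H.IsSolution φ) {p : ℝ} {i : ℕ}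
    (h : (p, i) ∈ φ.dom) (hinit : φ.val p i ∈ closure H.C ∪ H.D) :
    H.IsSolution (φ.tail p i h) := by
  have hint : ∀ j t, t ∈ interior ((φ.tail p i h).flowInterval j) →
      t + p ∈ interior (φ.flowInterval (j + i)) := by
    intro j t ht
    have hsub : interior ((φ.tail p i h).flowInterval j) ⊆
        interior ((Homeomorph.addRight p) ⁻¹' φ.flowInterval (j + i)) :=
      interior_mono fun s hs => hs.2
    rw [← (Homeomorph.addRight p).preimage_interior] at hsub
    exact hsub ht
  refine ⟨?_, fun j t ht => hφ.flow_mem (j + i) (t + p) (hint j t ht), fun j hj => ?_,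
    fun t j h1 h2 => ?_⟩
  · simpa [HybridArc.tail] using hinit
  · obtain ⟨t₀, ht₀⟩ := hj
    have hφd := (ae_restrict_iff' (φ.isHybridTimeDomain.measurableSet_section (j + i))).1
      (hφ.flow_deriv (j + i) ⟨_, hint j t₀ ht₀⟩)
    -- Translation preserves Lebesgue measure, so the exceptional null set can be shifted by `p`.
    have hsh := (measurePreserving_add_right (volume : Measure ℝ) p).quasiMeasurePreserving.ae hφd
    refine (ae_restrict_iff'
      ((φ.tail p i h).isHybridTimeDomain.measurableSet_section j)).2 ?_
    filter_upwards [hsh] with t ht hmem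
    obtain ⟨v, hv, hd⟩ := ht hmem.2
    exact ⟨v, hv, hd.comp_add_const t p⟩
  · have h2' : (t + p, j + i + 1) ∈ φ.dom := by
      rw [add_right_comm]
      exact h2.2
    have := hφ.jump (t + p) (j + i) h1.2 h2'
    rw [add_right_comm j i 1] at this
    exact this

end HybridSystem

/-- A solution restricted to the hybrid times before some point of its domain: flows on
`[time j, time (j + 1)]` for `j ≤ last`, with jumps in between. -/
structure TruncatedSolution {n : ℕ} (H : HybridSystem n) where
  time : ℕ → ℝ
  last : ℕ
  val : ℕ → ℝ → EuclideanSpace ℝ (Fin n)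
  time_mono : Monotone time
  time_zero : time 0 = 0
  init : val 0 0 ∈ H.C ∪ H.D
  isFlow : ∀ j ≤ last, H.IsFlow (val j) (time j) (time (j + 1))
  jump : ∀ j < last, val j (time (j + 1)) ∈ H.D ∧
    val (j + 1) (time (j + 1)) ∈ H.G (val j (time (j + 1)))

namespace HybridSystem

variable {n : ℕ} {H : HybridSystem n}

theorem IsSolution.exists_truncation (hC : IsClosed H.C) {φ : HybridArc n} (hφ : H.IsSolution φ)
    {τ : ℝ} {m : ℕ} (h : (τ, m) ∈ φ.dom) :
    ∃ x : TruncatedSolution H, x.last = m ∧ x.time (m + 1) = τ ∧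
      (∀ j t, x.val j t = φ.val t j) ∧
      ∀ j ≤ m, ∀ t ∈ Icc (x.time j) (x.time (j + 1)), (t, j) ∈ φ.dom := by
  obtain ⟨a, am, a0, aτ, h1, -⟩ := φ.isHybridTimeDomain.exists_jumpTimes h
  refine ⟨⟨a, m, fun j t => φ.val t j, am, a0, ?_, fun j hj => hφ.isFlow (am (Nat.le_succ j))
    (h1 j hj), fun j hj => ?_⟩, rfl, aτ, fun _ _ => rfl, h1⟩
  · simpa [hC.closure_eq] using hφ.init
  · exact hφ.jump _ _ (h1 j hj.le _ ⟨am (Nat.le_succ j), le_rfl⟩)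
      (h1 (j + 1) hj _ ⟨le_rfl, am (Nat.le_succ _)⟩)

end HybridSystem

/-! ### Limits of sequences of truncated solutions. -/

section Limit

variable {n : ℕ} {H : HybridSystem n}

/-- Uniform boundedness of the `j`-th flows up to time `T`, for almost all indices. -/
abbrev TruncatedSolution.BddUpTo (𝒰 : Ultrafilter ℕ) (x : ℕ → TruncatedSolution H) (j : ℕ)
    (T : ℝ) : Prop :=
  BoundedUpTo 𝒰 (fun k => (x k).val j) (fun k => (x k).time j) (fun k => (x k).time (j + 1)) T

/-- The value at `(t, j)` of the limit of a sequence of truncated solutions. -/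
noncomputable abbrev TruncatedSolution.limit (𝒰 : Ultrafilter ℕ) (x : ℕ → TruncatedSolution H)
    (t : ℝ) (j : ℕ) : EuclideanSpace ℝ (Fin n) :=
  flowLimit 𝒰 (fun k => (x k).val j) (fun k => (x k).time j) (fun k => (x k).time (j + 1)) t

variable {𝒰 : Ultrafilter ℕ} {x : ℕ → TruncatedSolution H} {A : ℕ → EReal}

open TruncatedSolution

theorem TruncatedSolution.eventually_isFlow {j : ℕ} (h : ∀ᶠ k in 𝒰, j ≤ (x k).last) :
    ∀ᶠ k in 𝒰, (x k).time j ≤ (x k).time (j + 1) ∧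
      H.IsFlow ((x k).val j) ((x k).time j) ((x k).time (j + 1)) :=
  h.mono fun k hk => ⟨(x k).time_mono (Nat.le_succ j), (x k).isFlow j hk⟩

theorem eventually_lt_of_tendsto_ereal {u : ℕ → ℝ} {a : EReal} {T : ℝ}
    (hu : Tendsto (fun k => (u k : EReal)) 𝒰 (𝓝 a)) (h : a < T) : ∀ᶠ k in 𝒰, u k < T :=
  (hu.eventually (gt_mem_nhds h)).mono fun _ hk => EReal.coe_lt_coe_iff.1 hk

theorem eventually_gt_of_tendsto_ereal {u : ℕ → ℝ} {a : EReal} {T : ℝ}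
    (hu : Tendsto (fun k => (u k : EReal)) 𝒰 (𝓝 a)) (h : T < a) : ∀ᶠ k in 𝒰, T < u k :=
  (hu.eventually (lt_mem_nhds h)).mono fun _ hk => EReal.coe_lt_coe_iff.1 hk

/-- The domain `E` is left free because the result is used twice: on a domain stopping short of a
supposed blow-up time, and on an unbounded domain. -/
theorem TruncatedSolution.exists_limit (hH : H.BasicConditions)
    (hA : ∀ j, Tendsto (fun k => ((x k).time j : EReal)) 𝒰 (𝓝 (A j)))
    (hlast : ∀ j, A j < ⊤ → ∀ᶠ k in 𝒰, j ≤ (x k).last)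
    {E : Set (ℝ × ℕ)} (hE : IsHybridTimeDomain E)
    (hsub : ∀ t j, (t, j) ∈ E → A j ≤ (t : EReal) ∧ (t : EReal) ≤ A (j + 1))
    (hbdd : ∀ t j, (t, j) ∈ E → ∃ T, t < T ∧ BddUpTo 𝒰 x j T) :
    ∃ φ : HybridArc n, H.IsSolution φ ∧ φ.dom = E ∧
      ∀ t j, (t, j) ∈ E → Tendsto (fun k => (x k).val j
        (clampIcc ((x k).time j) ((x k).time (j + 1)) t)) 𝒰 (𝓝 (φ.val t j)) := by
  have hfl : ∀ t j, (t, j) ∈ E → ∀ᶠ k in 𝒰, (x k).time j ≤ (x k).time (j + 1) ∧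
      H.IsFlow ((x k).val j) ((x k).time j) ((x k).time (j + 1)) := fun t j h =>
    eventually_isFlow (hlast j ((hsub t j h).1.trans_lt (EReal.coe_lt_top t)))
  have hlt : ∀ t j, (t, j) ∈ E → ∀ T, t < T → ∀ᶠ k in 𝒰, (x k).time j < T := fun t j h T hT =>
    eventually_lt_of_tendsto_ereal (hA j) ((hsub t j h).1.trans_lt (EReal.coe_lt_coe_iff.2 hT))
  have htend : ∀ t j, (t, j) ∈ E → ∀ u : ℕ → ℝ, Tendsto u 𝒰 (𝓝 t) →
      Tendsto (fun k => (x k).val j (clampIcc ((x k).time j) ((x k).time (j + 1)) (u k))) 𝒰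
        (𝓝 (limit 𝒰 x t j)) := by
    intro t j h u hu
    obtain ⟨T, htT, hT⟩ := hbdd t j h
    exact tendsto_flowLimit_of_tendsto (hfl t j h) hH hT
      ((hlt t j h T htT).mono fun _ h => h.le) htT hu
  have hint : ∀ j t, t ∈ interior {t | (t, j) ∈ E} → A j < (t : EReal) ∧ (t : EReal) < A (j + 1) := by
    intro j t ht
    obtain ⟨ε, hε, hball⟩ := Metric.mem_nhds_iff.1 (mem_interior_iff_mem_nhds.1 ht)
    have h1 : (t - ε / 2, j) ∈ E := hball (by simp [abs_of_pos hε, hε])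
    have h2 : (t + ε / 2, j) ∈ E := hball (by simp [abs_of_pos hε, hε])
    exact ⟨(hsub _ _ h1).1.trans_lt (EReal.coe_lt_coe_iff.2 (by linarith)),
      (EReal.coe_lt_coe_iff.2 (by linarith)).trans_le (hsub _ _ h2).2⟩
  have hac : ∀ (j : ℕ) (a b : ℝ), (a, j) ∈ E → (b, j) ∈ E →
      AbsolutelyContinuousOnInterval (fun t => limit 𝒰 x t j) a b := by
    intro j a b ha hb
    wlog hab : a ≤ b generalizing a b
    · exact (this b a hb ha (le_of_not_ge hab)).symm
    obtain ⟨T, hbT, hT⟩ := hbdd b j hb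
    obtain ⟨M, hM⟩ := exists_lipschitzOnWith_flowLimit (hfl b j hb) hH hT
      ((hlt b j hb T hbT).mono fun _ h => h.le)
    refine (hM.mono ?_).absolutelyContinuousOnInterval
    rw [uIcc_of_le hab]
    exact fun s hs => hs.2.trans hbT.le
  refine ⟨⟨E, limit 𝒰 x, hE, hac⟩, ⟨?_, fun j t ht => ?_, fun j hj => ?_, fun t j h1 h2 => ?_⟩,
    rfl, fun t j h => htend t j h _ tendsto_const_nhds⟩
  · rw [hH.isClosed_C.closure_eq]
    refine (hH.isClosed_C.union hH.isClosed_D).mem_of_tendsto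
      (htend 0 0 hE.zero_mem _ tendsto_const_nhds) (Eventually.of_forall fun k => ?_)
    rw [clampIcc_of_mem]
    · exact (x k).init
    · have := (x k).time_mono (Nat.zero_le 1)
      rw [(x k).time_zero] at this ⊢
      exact ⟨le_rfl, this⟩
  · have htE : (t, j) ∈ E := interior_subset (s := {t | (t, j) ∈ E}) ht
    obtain ⟨T, htT, hT⟩ := hbdd t j htE
    obtain ⟨ha, hb⟩ := hint j t ht
    refine flowLimit_mem (hfl t j htE) hH hT htT.le ?_
    filter_upwards [eventually_lt_of_tendsto_ereal (hA j) ha,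
      eventually_gt_of_tendsto_ereal (hA (j + 1)) hb] with k h1 h2 using ⟨h1, h2⟩
  · obtain ⟨t₀, ht₀⟩ := hj
    have ht₀E : (t₀, j) ∈ E := interior_subset (s := {t | (t, j) ∈ E}) ht₀
    have hdiff := ae_differentiableAt_flowLimit (hfl t₀ j ht₀E) hH
    refine (ae_restrict_iff' (hE.measurableSet_section j)).2 ?_
    -- Discarding the limiting end times makes `t` interior to the limit interval; for infinite
    -- ends, `toReal` merely discards the harmless point `0`.
    have hnull : ∀ b : ℝ, ∀ᵐ t : ℝ, t ≠ b := fun b => by simp [ae_iff]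
    filter_upwards [hdiff, hnull (A j).toReal, hnull (A (j + 1)).toReal] with t hd hn1 hn2 htE
    obtain ⟨T, htT, hT⟩ := hbdd t j htE
    obtain ⟨ha, hb⟩ := hsub t j htE
    have ha : A j < (t : EReal) := lt_of_le_of_ne ha fun h => hn1 (by rw [h, EReal.toReal_coe])
    have hb : (t : EReal) < A (j + 1) :=
      lt_of_le_of_ne hb fun h => hn2 (by rw [← h, EReal.toReal_coe])
    obtain ⟨t₂, ht₂, ht₂'⟩ := EReal.lt_iff_exists_real_btwn.1 hb
    have hta := eventually_lt_of_tendsto_ereal (hA j) ha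
    have hdt := (hd T htT hT hta).hasDerivAt
    refine ⟨_, ?_, hdt⟩
    refine mem_of_hasDerivAt_flowLimit (hfl t j htE) hH hT htT (EReal.coe_lt_coe_iff.1 ht₂) ?_ hdt
    filter_upwards [hta, eventually_gt_of_tendsto_ereal (hA (j + 1)) ht₂'] with k h1 h2
      using ⟨h1, h2⟩
  -- Membership in two successive sections forces the limit jump time to be `t`, so evaluation at
  -- the actual jump times converges on both sides of the jump.
  · have htA : A (j + 1) = (t : EReal) := le_antisymm (hsub _ _ h2).1 (hsub _ _ h1).2
    have hu : Tendsto (fun k => (x k).time (j + 1)) 𝒰 (𝓝 t) := by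
      have := hA (j + 1)
      rw [htA] at this
      exact EReal.tendsto_coe.1 this
    have hgr := hH.osc_G.isClosed_graph hH.isClosed_D
    have hlim := (htend t j h1 _ hu).prodMk_nhds (htend t (j + 1) h2 _ hu)
    refine hgr.mem_of_tendsto hlim ?_
    filter_upwards [hlast (j + 1) (by rw [htA]; exact EReal.coe_lt_top t)] with k hk
    rw [clampIcc_of_mem ⟨(x k).time_mono (Nat.le_succ j), le_rfl⟩,
      clampIcc_of_mem ⟨le_rfl, (x k).time_mono (Nat.le_succ _)⟩]
    exact (x k).jump j hk

end Limit

/-- Monotonicity is required only up to `J`: later values of `a` may be junk, such as the `toReal`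
of an infinite limit time. -/
theorem IsHybridTimeDomain.of_jumpTimes {a : ℕ → ℝ} {J : ℕ} {I : Set ℝ} (a0 : a 0 = 0)
    (ha : ∀ i < J, a i ≤ a (i + 1))
    (hI : (∃ T, a J < T ∧ I = Ico (a J) T) ∨ I = Ici (a J)) :
    IsHybridTimeDomain
      {p | (p.2 < J ∧ p.1 ∈ Icc (a p.2) (a (p.2 + 1))) ∨ (p.2 = J ∧ p.1 ∈ I)} := by
  have key : ∀ T, a J ≤ T → ((a J < T ∧ I = Ico (a J) T) ∨ I = Ici (a J)) →
      IsHybridTimeDomain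
        {p | (p.2 < J ∧ p.1 ∈ Icc (a p.2) (a (p.2 + 1))) ∨ (p.2 = J ∧ p.1 ∈ I)} := by
    intro T hT hIT
    have h1 : ∀ i ≤ J, (if i ≤ J then a i else T) = a i := fun i hi => if_pos hi
    have h2 : ∀ i, J < i → (if i ≤ J then a i else T) = T := fun i hi => if_neg (not_le.2 hi)
    refine ⟨fun i => if i ≤ J then a i else T, by simp [a0], monotone_nat_of_le_succ fun i => ?_,
      Or.inr ⟨J, I, Or.inr ?_, ?_⟩⟩
    · rcases lt_trichotomy i J with hi | rfl | hi
      · rw [h1 i hi.le, h1 _ hi]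
        exact ha i hi
      · simpa using hT
      · rw [h2 i hi, h2 _ (by omega)]
    · simpa using hIT
    · ext ⟨s, i⟩
      simp only [mem_ofPred_eq]
      refine or_congr (and_congr_right fun hi => ?_) Iff.rfl
      rw [h1 i hi.le, h1 _ hi]
  rcases hI with ⟨T, hT, h⟩ | h
  · exact key T hT.le (Or.inl ⟨hT, h⟩)
  · exact key (a J) le_rfl (Or.inr h)

/-! ### Absence of blow-up and completeness of the limit. -/

namespace TruncatedSolution

variable {n : ℕ} {H : HybridSystem n} {𝒰 : Ultrafilter ℕ} {x : ℕ → TruncatedSolution H}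
  {θ : ℕ → EReal} {X₀ B : Set (EuclideanSpace ℝ (Fin n))}

theorem exists_limit_from (hH : H.BasicConditions)
    (hθ : ∀ j, Tendsto (fun k => ((x k).time j : EReal)) 𝒰 (𝓝 (θ j)))
    (hlast : ∀ j, θ j < ⊤ → ∀ᶠ k in 𝒰, j ≤ (x k).last)
    (hX₀ : IsClosed X₀) (hx : ∀ k, (x k).val 0 0 ∈ X₀)
    {E : Set (ℝ × ℕ)} (hE : IsHybridTimeDomain E)
    (hsub : ∀ t j, (t, j) ∈ E → θ j ≤ (t : EReal) ∧ (t : EReal) ≤ θ (j + 1))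
    (hbdd : ∀ t j, (t, j) ∈ E → ∃ T, t < T ∧ BddUpTo 𝒰 x j T) :
    ∃ φ : HybridArc n, H.IsSolution φ ∧ φ.val 0 0 ∈ X₀ ∧ φ.dom = E ∧
      ∀ t j, (t, j) ∈ E → Tendsto (fun k => (x k).val j
        (clampIcc ((x k).time j) ((x k).time (j + 1)) t)) 𝒰 (𝓝 (φ.val t j)) := by
  obtain ⟨φ, h1, h2, h3⟩ := exists_limit hH hθ hlast hE hsub hbdd
  refine ⟨φ, h1, hX₀.mem_of_tendsto (h3 0 0 hE.zero_mem) (Eventually.of_forall fun k => ?_), h2, h3⟩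
  rw [clampIcc_of_mem]
  · exact hx k
  · have := (x k).time_mono (Nat.zero_le 1)
    rw [(x k).time_zero] at this ⊢
    exact ⟨le_rfl, this⟩

theorem limitTime_le_succ (hθ : ∀ j, Tendsto (fun k => ((x k).time j : EReal)) 𝒰 (𝓝 (θ j)))
    (j : ℕ) : θ j ≤ θ (j + 1) :=
  le_of_tendsto_of_tendsto' (hθ j) (hθ (j + 1)) fun k =>
    EReal.coe_le_coe_iff.2 ((x k).time_mono (Nat.le_succ j))

theorem limitTime_zero (hθ : ∀ j, Tendsto (fun k => ((x k).time j : EReal)) 𝒰 (𝓝 (θ j))) :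
    θ 0 = 0 := by
  have h := hθ 0
  simp only [(x _).time_zero] at h
  exact tendsto_nhds_unique h tendsto_const_nhds

theorem coe_toReal_limitTime
    (hθ : ∀ j, Tendsto (fun k => ((x k).time j : EReal)) 𝒰 (𝓝 (θ j))) {j : ℕ} (hj : θ j < ⊤) :
    ((θ j).toReal : EReal) = θ j := by
  refine EReal.coe_toReal hj.ne fun h => ?_
  have := monotone_nat_of_le_succ (limitTime_le_succ hθ) (Nat.zero_le j)
  rw [limitTime_zero hθ, h] at this
  simp at this

/-- Limits of solutions whose start lies in a compact part of the basin do not blow up. -/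
theorem bddUpTo (hH : H.BasicConditions)
    (hθ : ∀ j, Tendsto (fun k => ((x k).time j : EReal)) 𝒰 (𝓝 (θ j)))
    (hlast : ∀ j, θ j < ⊤ → ∀ᶠ k in 𝒰, j ≤ (x k).last)
    (hX₀ : IsCompact X₀) (hx : ∀ k, (x k).val 0 0 ∈ X₀) (hB : X₀ ⊆ H.basin B) (j : ℕ)
    (hj : θ j < ⊤) (T : ℝ) : BddUpTo 𝒰 x j T := by
  induction j using Nat.strong_induction_on generalizing T with
  | _ j ih =>
  have hmono := monotone_nat_of_le_succ (limitTime_le_succ hθ)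
  have hcoe : ∀ i ≤ j, ((θ i).toReal : EReal) = θ i := fun i hi =>
    coe_toReal_limitTime hθ ((hmono hi).trans_lt hj)
  have hfl := eventually_isFlow (hlast j hj)
  -- The flow starts in the compact `X₀` or, after a jump, in the image under `G` of points that are
  -- bounded by induction.
  have hstart : ∃ R, ∀ᶠ k in 𝒰, ‖(x k).val j ((x k).time j)‖ ≤ R := by
    rcases j with _ | i
    · obtain ⟨R, hR⟩ := hX₀.isBounded.exists_norm_le
      refine ⟨R, Eventually.of_forall fun k => ?_⟩
      rw [(x k).time_zero]
      exact hR _ (hx k)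
    · obtain ⟨R, hR⟩ := ih i (Nat.lt_succ_self i) ((hmono (Nat.le_succ i)).trans_lt hj)
        ((θ (i + 1)).toReal + 1)
      obtain ⟨M, -, hM⟩ := hH.locallyBounded_G.exists_bound hH.isClosed_D R
      refine ⟨M, ?_⟩
      have hlt : θ (i + 1) < (((θ (i + 1)).toReal + 1 : ℝ) : EReal) := by
        conv_lhs => rw [← hcoe (i + 1) le_rfl]
        exact EReal.coe_lt_coe_iff.2 (lt_add_one _)
      filter_upwards [hR, hlast (i + 1) hj, eventually_lt_of_tendsto_ereal (hθ (i + 1)) hlt]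
        with k hk hki hkt
      obtain ⟨h1, h2⟩ := (x k).jump i hki
      exact hM _ h1 (hk _ ⟨(x k).time_mono (Nat.le_succ i), le_rfl⟩ hkt.le) _ h2
  by_contra hT
  have hbddAbove : BddAbove {S | BddUpTo 𝒰 x j S} :=
    ⟨T, fun S hS => le_of_not_gt fun h => hT (BoundedUpTo.mono hS h.le)⟩
  obtain ⟨S₀, hS₀, hS₀b⟩ : ∃ S, (θ j).toReal < S ∧ BddUpTo 𝒰 x j S := by
    obtain ⟨R, hR⟩ := hstart
    obtain ⟨M, hM0, hM⟩ := hH.locallyBounded_F.exists_bound hH.isClosed_C (R + 1)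
    -- Start times are eventually within `1 / (4 * M)` of their limit, so the elapsed time is at
    -- most `2 / (4 * M)` and the distance travelled at speed `M` stays below `1`.
    have hη : 0 < 1 / (4 * M) := by positivity
    refine ⟨(θ j).toReal + 1 / (4 * M), by linarith, R + 1, ?_⟩
    have hlt : (((θ j).toReal - 1 / (4 * M) : ℝ) : EReal) < θ j := by
      conv_rhs => rw [← hcoe j le_rfl]
      exact EReal.coe_lt_coe_iff.2 (by linarith)
    filter_upwards [hR, hfl, eventually_gt_of_tendsto_ereal (hθ j) hlt] with k hk hfk hlt s hs hsT
    refine (hfk.2.mono le_rfl hs.1 hs.2).norm_le_add_one hs.1 hM0 hM hk ?_ s ⟨hs.1, le_rfl⟩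
    calc M * (s - (x k).time j) ≤ M * (2 * (1 / (4 * M))) := by gcongr; linarith
      _ < 1 := by field_simp; norm_num
  set S := sSup {S | BddUpTo 𝒰 x j S} with hS
  have hjS : (θ j).toReal < S := hS₀.trans_le (le_csSup hbddAbove hS₀b)
  have hbelow : ∀ t < S, BddUpTo 𝒰 x j t := by
    intro t ht
    obtain ⟨t', ht', htt'⟩ := exists_lt_of_lt_csSup ⟨S₀, hS₀b⟩ ht
    exact BoundedUpTo.mono ht' htt'.le
  -- Otherwise almost all `j`-th flows end before some time below `S`, and a bound up to that time
  -- bounds them entirely.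
  have hSle : (S : EReal) ≤ θ (j + 1) := by
    by_contra! h
    obtain ⟨q, hq1, hq2⟩ := EReal.lt_iff_exists_real_btwn.1 h
    obtain ⟨R, hR⟩ := hbelow q (EReal.coe_lt_coe_iff.1 hq2)
    refine hT ⟨R, ?_⟩
    filter_upwards [hR, eventually_lt_of_tendsto_ereal (hθ (j + 1)) hq1] with k hk hkq s hs _
    exact hk s hs (hs.2.trans hkq.le)
  have hE : IsHybridTimeDomain {p : ℝ × ℕ | (p.2 < j ∧
      p.1 ∈ Icc (θ p.2).toReal (θ (p.2 + 1)).toReal) ∨ (p.2 = j ∧ p.1 ∈ Ico (θ j).toReal S)} := by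
    refine IsHybridTimeDomain.of_jumpTimes (a := fun i => (θ i).toReal)
      (by simp [limitTime_zero hθ]) (fun i hi => ?_) (Or.inl ⟨S, hjS, rfl⟩)
    rw [← EReal.coe_le_coe_iff, hcoe i hi.le, hcoe (i + 1) hi]
    exact limitTime_le_succ hθ i
  obtain ⟨φ, hφ, hφ0, hdom, hlim⟩ := exists_limit_from hH hθ hlast hX₀.isClosed hx hE
    (fun t i hti => by
      rcases hti with ⟨hi, h⟩ | ⟨hi, h⟩
      · simp only at hi h
        rw [← hcoe i hi.le, ← hcoe (i + 1) hi]
        exact ⟨EReal.coe_le_coe_iff.2 h.1, EReal.coe_le_coe_iff.2 h.2⟩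
      · simp only at hi h
        subst hi
        refine ⟨?_, (EReal.coe_le_coe_iff.2 h.2.le).trans hSle⟩
        rw [← hcoe i le_rfl]
        exact EReal.coe_le_coe_iff.2 h.1)
    (fun t i hti => by
      rcases hti with ⟨hi, h⟩ | ⟨hi, h⟩
      · exact ⟨t + 1, lt_add_one t, ih i hi ((hmono hi.le).trans_lt hj) _⟩
      · simp only at hi h
        subst hi
        obtain ⟨t', h1, h2⟩ := exists_between h.2
        exact ⟨t', h1, hbelow t' h2⟩)
  -- The limit on the domain ending just before `S` is a solution from `X₀`, so the basin bounds it,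
  -- with `R` independent of the distance to `S`.
  obtain ⟨R, hR⟩ := (hB hφ0 φ hφ rfl).1.exists_norm_le
  obtain ⟨M, hM0, hM⟩ := hH.locallyBounded_F.exists_bound hH.isClosed_C (R + 1 + 1)
  have hη : 0 < 1 / (4 * M) := by positivity
  have htS : max (θ j).toReal (S - 1 / (4 * M)) < S := max_lt hjS (by linarith)
  have htE : (max (θ j).toReal (S - 1 / (4 * M)), j) ∈ φ.dom := by
    rw [hdom]
    exact Or.inr ⟨rfl, mem_Ico.2 ⟨le_max_left _ _, htS⟩⟩
  have hnorm := (hlim _ j (hdom ▸ htE)).norm.eventually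
    (gt_mem_nhds ((hR _ ⟨_, j, htE, rfl⟩).trans_lt (lt_add_one R)))
  obtain ⟨R', hR'⟩ := hbelow _ htS
  have hmax : S - 1 / (4 * M) ≤ max (θ j).toReal (S - 1 / (4 * M)) := le_max_right _ _
  generalize max (θ j).toReal (S - 1 / (4 * M)) = t at htS hnorm hR' hmax
  -- At a time at most `1 / (4 * M)` before `S` the flows have norm below `R + 1`. They need longer
  -- than `2 / (4 * M)` to gain another unit, which contradicts the choice of `S`.
  have hbeyond : BddUpTo 𝒰 x j (S + 1 / (4 * M)) := by
    refine ⟨max R' (R + 1 + 1), ?_⟩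
    filter_upwards [hR', hfl, hnorm] with k hk hfk hnk s hs hsS
    rcases le_total s t with hst | hst
    · exact (hk s hs hst).trans (le_max_left _ _)
    · refine le_trans ?_ (le_max_right _ _)
      have hcs : clampIcc ((x k).time j) ((x k).time (j + 1)) t ≤ s := clampIcc_le hs.1 hst
      have htc : t ≤ clampIcc ((x k).time j) ((x k).time (j + 1)) t :=
        (le_min le_rfl (hst.trans hs.2)).trans (le_max_right _ _)
      refine (hfk.2.mono (clampIcc_mem hfk.1 t).1 hcs hs.2).norm_le_add_one hcs hM0 hM hnk.le ?_ s
        ⟨hcs, le_rfl⟩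
      calc M * (s - clampIcc ((x k).time j) ((x k).time (j + 1)) t)
          ≤ M * (2 * (1 / (4 * M))) := by gcongr; linarith
        _ < 1 := by field_simp; norm_num
  have := le_csSup hbddAbove hbeyond
  rw [← hS] at this
  linarith

/-- The limit of longer and longer solutions from a compact part of the basin is a complete
solution. -/
theorem exists_complete_limit (hH : H.BasicConditions)
    (hθ : ∀ j, Tendsto (fun k => ((x k).time j : EReal)) 𝒰 (𝓝 (θ j)))
    (hlast : ∀ j, θ j < ⊤ → ∀ᶠ k in 𝒰, j ≤ (x k).last)
    (hX₀ : IsCompact X₀) (hx : ∀ k, (x k).val 0 0 ∈ X₀) (hB : X₀ ⊆ H.basin B) :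
    ∃ φ : HybridArc n, H.IsSolution φ ∧ φ.val 0 0 ∈ X₀ ∧ φ.IsComplete ∧
      ∀ t j, (t, j) ∈ φ.dom → (∀ᶠ k in 𝒰, j ≤ (x k).last) ∧ Tendsto (fun k => (x k).val j
        (clampIcc ((x k).time j) ((x k).time (j + 1)) t)) 𝒰 (𝓝 (φ.val t j)) := by
  have hle := limitTime_le_succ hθ
  have hmono := monotone_nat_of_le_succ hle
  have hzero : (θ 0).toReal = 0 := by simp [limitTime_zero hθ]
  have hcoe : ∀ {i}, θ i < ⊤ → ((θ i).toReal : EReal) = θ i := coe_toReal_limitTime hθ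
  have hreal : ∀ i, θ (i + 1) < ⊤ → (θ i).toReal ≤ (θ (i + 1)).toReal := fun i hi => by
    rw [← EReal.coe_le_coe_iff, hcoe hi, hcoe ((hle i).trans_lt hi)]
    exact hle i
  suffices h : ∃ E : Set (ℝ × ℕ), IsHybridTimeDomain E ∧
      (∀ t j, (t, j) ∈ E → θ j ≤ (t : EReal) ∧ (t : EReal) ≤ θ (j + 1)) ∧
      ∀ T : ℝ, ∃ (t : ℝ) (j : ℕ), (t, j) ∈ E ∧ T ≤ t + j by
    obtain ⟨E, hE, hsub, hcomplete⟩ := h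
    have hfin : ∀ t j, (t, j) ∈ E → θ j < ⊤ := fun t j h =>
      (hsub t j h).1.trans_lt (EReal.coe_lt_top t)
    obtain ⟨φ, h1, h2, h3, h4⟩ := exists_limit_from hH hθ hlast hX₀.isClosed hx hE hsub
      fun t j h => ⟨t + 1, lt_add_one t, bddUpTo hH hθ hlast hX₀ hx hB j (hfin t j h) _⟩
    subst h3
    exact ⟨φ, h1, h2, hcomplete, fun t j h => ⟨hlast j (hfin t j h), h4 t j h⟩⟩
  -- The domain is unbounded through infinitely many jumps if all limit times are finite, and
  -- otherwise through a last interval `[θ J, ∞)` before the first infinite one.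
  by_cases hall : ∀ j, θ j < ⊤
  · have hrm : Monotone fun i => (θ i).toReal :=
      monotone_nat_of_le_succ fun i => hreal i (hall _)
    refine ⟨_, ⟨fun i => (θ i).toReal, hzero, hrm, Or.inl rfl⟩, fun t j h => ?_, fun T => ?_⟩
    · rw [← hcoe (hall j), ← hcoe (hall (j + 1))]
      exact ⟨EReal.coe_le_coe_iff.2 h.1, EReal.coe_le_coe_iff.2 h.2⟩
    · obtain ⟨j, hj⟩ := exists_nat_ge T
      refine ⟨(θ j).toReal, j, ⟨le_rfl, hreal j (hall _)⟩, ?_⟩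
      have : 0 ≤ (θ j).toReal := hzero ▸ hrm (Nat.zero_le j)
      linarith
  · simp only [not_forall, not_lt_top_iff] at hall
    classical
    obtain ⟨J, hJ⟩ : ∃ J, Nat.find hall = J + 1 := Nat.exists_eq_succ_of_ne_zero fun h => by
      have := Nat.find_spec hall
      rw [h, limitTime_zero hθ] at this
      simp at this
    have htop : θ (J + 1) = ⊤ := hJ ▸ Nat.find_spec hall
    have hfin : ∀ i ≤ J, θ i < ⊤ := fun i hi =>
      lt_top_iff_ne_top.2 (Nat.find_min hall (by omega))
    refine ⟨_, IsHybridTimeDomain.of_jumpTimes (a := fun i => (θ i).toReal) (J := J) hzero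
      (fun i hi => hreal i (hfin _ hi)) (Or.inr rfl), fun t j h => ?_, fun T => ?_⟩
    · rcases h with ⟨hj, h⟩ | ⟨hj, h⟩
      · simp only at hj h
        rw [← hcoe (hfin j hj.le), ← hcoe (hfin (j + 1) hj)]
        exact ⟨EReal.coe_le_coe_iff.2 h.1, EReal.coe_le_coe_iff.2 h.2⟩
      · simp only at hj h
        subst hj
        rw [htop, ← hcoe (hfin j le_rfl)]
        exact ⟨EReal.coe_le_coe_iff.2 h, le_top⟩
    · refine ⟨max (θ J).toReal T, J, Or.inr ⟨rfl, mem_Ici.2 (le_max_left _ _)⟩, ?_⟩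
      have := le_max_right (θ J).toReal T
      have : (0 : ℝ) ≤ J := J.cast_nonneg
      linarith

end TruncatedSolution

/-! ### Uniform attraction on compact sets and the proposition. -/

namespace HybridSystem

variable {n : ℕ} {H : HybridSystem n} {X₀ B : Set (EuclideanSpace ℝ (Fin n))}

/-- Under the hybrid basic conditions, attraction is uniform on compact subsets of the basin of
pre-attraction of a uniformly pre-asymptotically stable set. -/
theorem UpAS.exists_time_forall_infEDist_lt (hB : H.UpAS B) (hH : H.BasicConditions)
    (hX₀ : IsCompact X₀) (hsub : X₀ ⊆ H.basin B) {ε : ℝ} (hε : 0 < ε) :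
    ∃ T : ℝ, 0 ≤ T ∧ ∀ φ : HybridArc n, H.IsSolution φ → φ.val 0 0 ∈ X₀ →
      ∀ (t : ℝ) (j : ℕ), (t, j) ∈ φ.dom → T ≤ t + j →
        Metric.infEDist (φ.val t j) B < ENNReal.ofReal ε := by
  by_contra! hcon
  choose φ hφ hφ0 τ m hdom hlong hfar using fun k : ℕ => hcon k k.cast_nonneg
  choose x hxlast hxτ hxval hxdom using fun k =>
    (hφ k).exists_truncation hH.isClosed_C (hdom k)
  set 𝒰 : Ultrafilter ℕ := hyperfilter ℕ
  have hlim : ∀ j, ∃ a : EReal, Tendsto (fun k => ((x k).time j : EReal)) 𝒰 (𝓝 a) := fun j => by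
    obtain ⟨a, -, ha⟩ := isCompact_univ.ultrafilter_le_nhds
      (𝒰.map fun k => ((x k).time j : EReal)) (by simp)
    exact ⟨a, ha⟩
  choose θ hθ using hlim
  -- If the `k`-th truncation had fewer than `j` jumps, its end time would be at most its `j`-th
  -- time, below `T`; its hybrid length would then be less than `T + j`, hence less than `k`.
  have hlast : ∀ j, θ j < ⊤ → ∀ᶠ k in 𝒰, j ≤ (x k).last := by
    intro j hj
    obtain ⟨T, hT, -⟩ := EReal.lt_iff_exists_real_btwn.1 hj
    have hk : ∀ᶠ k : ℕ in 𝒰, T + j ≤ k :=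
      (tendsto_natCast_atTop_atTop.eventually_ge_atTop (T + j)).filter_mono
        Nat.hyperfilter_le_atTop
    filter_upwards [hk, eventually_lt_of_tendsto_ereal (hθ j) hT] with k hk hkT
    by_contra! h
    rw [hxlast] at h
    have h1 := (x k).time_mono (Nat.succ_le_of_lt h)
    rw [Nat.succ_eq_add_one, hxτ] at h1
    have h2 : (m k : ℝ) < j := Nat.cast_lt.2 h
    linarith [hlong k]
  obtain ⟨r, hr, hstab⟩ := hB.uniformStability ε hε
  obtain ⟨ψ, hψ, hψ0, hψc, hψlim⟩ := TruncatedSolution.exists_complete_limit hH hθ hlast hX₀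
    (fun k => by rw [hxval]; exact hφ0 k) hsub
  -- The radius `r` triggers stability; `ε` covers the case where the nearby point is already the
  -- bad one.
  obtain ⟨T, hT⟩ := (hsub hψ0 ψ hψ rfl).2 hψc (min r ε) (lt_min hr hε)
  obtain ⟨t, j, htj, hTt⟩ := hψc T
  obtain ⟨hj, htend⟩ := hψlim t j htj
  have hnear := ((Metric.continuous_infEDist (s := B)).tendsto _).comp htend |>.eventually
    (gt_mem_nhds (hT t j htj hTt))
  obtain ⟨k, hk, hjk⟩ := (hnear.and hj).exists
  have hc := clampIcc_mem ((x k).time_mono (Nat.le_succ j)) t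
  simp only [Function.comp_apply, hxval] at hk
  generalize clampIcc ((x k).time j) ((x k).time (j + 1)) t = c at hk hc
  rw [hxlast] at hjk
  have hcdom := hxdom k j hjk c hc
  have hcτ : c ≤ τ k := by
    rw [← hxτ k]
    exact hc.2.trans ((x k).time_mono (Nat.succ_le_succ hjk))
  refine (hfar k).not_gt ?_
  -- A tail starting at the bad point need not be a solution, as a final point may lie outside
  -- `closure C ∪ D`; but there closeness alone contradicts the choice of the point.
  by_cases heq : c = τ k ∧ j = m k
  · rw [← heq.1, ← heq.2]
    exact hk.trans_le (ENNReal.ofReal_le_ofReal (min_le_right _ _))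
  · have htail := (hφ k).tail hcdom ((hφ k).mem_of_later hcdom (hdom k) hcτ hjk heq)
    have := hstab _ htail (by
      simpa [HybridArc.tail] using hk.trans_le (ENNReal.ofReal_le_ofReal (min_le_left _ _)))
      (τ k - c) (m k - j) (by
        refine ⟨sub_nonneg.2 hcτ, ?_⟩
        simpa [Nat.sub_add_cancel hjk] using hdom k)
    simpa [HybridArc.tail, Nat.sub_add_cancel hjk] using this

end HybridSystem

theorem mainTheorem7 {n : ℕ} (H : HybridSystem n) (δ : ℝ) (hδ : 0 ≤ δ)
    (hH : (H.perturb δ).BasicConditions)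
    (X₀ U A : Set (EuclideanSpace ℝ (Fin n))) (hA : IsCompact A) (hX₀ : IsCompact X₀)
    (hS : (H.perturb δ).StabilityWithSafety X₀ U A) :
    ∀ ε : ℝ, 0 < ε →
      (H.perturb δ).ReachAvoidStay X₀ U (A + Metric.closedBall 0 ε) := by
  intro ε hε
  obtain ⟨T, hT0, hT⟩ := hS.upAS.exists_time_forall_infEDist_lt hH hX₀ hS.subset_basin hε
  refine ⟨⟨T, hT0, ?_⟩, hS.safe⟩
  rintro _ ⟨φ, ⟨hφ, hφ0⟩, t, j, htj, hTt, rfl⟩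
  have hdist := hT φ hφ.1 hφ0 t j htj hTt
  rw [hA.add_closedBall_zero hε.le, Metric.mem_cthickening_iff]
  exact hdist.le
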